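/- For each integer $N\ge 1$ let $\mathbf r(N)=(r_1\ge r_2\ge\dots\ge r_{m})$ and $\mathbf c(N)=(c_1\ge c_2\ge\dots\ge c_{n})$ be vectors of nonnegative integers, of lengths $m=m(N)$ and $n=n(N)$, with $\sum_{i} r_i=\sum_{j} c_j=N$ and $r_1\ge c_1$; put $r_i=0$ for $i>m$. Let $\Omega_{\mathbf r,\mathbf c}$ be the set of $m\times n$ matrices with entries in $\{0,1\}$, row sums $\mathbf r$ and column sums $\mathbf c$, identified with bipartite graphs having these degrees. The configuration model takes $r_i$ tokens of type 1 for each row $i$ and $c_j$ tokens of type 2 for each column $j$, draws a uniformly random perfect matching between type-1 and type-2 tokens, and outputs the table (bipartite multigraph) whose $(i,j)$ entry is the number of type-1 tokens of row $i$ matched to type-2 tokens of column $j$. For a subsequence $S'=(\mathbf r'(\ell),\mathbf c'(\ell),N'(\ell))_{\ell}$ of $(\mathbf r(N),\mathbf c(N),N)_{N}$ let $\kappa(S')=\min\{i\ge1: r'_i(\ell)=o(N'(\ell))\text{ as }\ell\to\infty\}$, with $\kappa(S')=\infty$ if there is no such $i$; in that case $\sum_{i=\kappa(S')}^\infty r'_i(\ell)/N'(\ell)$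 is defined as $0$. Assume that 1. $\sum_{i=1}^m\sum_{j=1}^n r_i(r_i-1)c_j(c_j-1)=O(N^2)$ as $N\to\infty$; and 2. for every subsequence $S'$, either $\limsup_{\ell\to\infty}\sum_{i=\kappa(S')}^\infty r'_i(\ell)/N'(\ell)>0$ or $\limsup_{\ell\to\infty}c'_1(\ell)<\kappa(S')$. Let $A$ be any property of (labelled) bipartite multigraphs. Let $p'(A)$ be the probability that the output of the configuration model given $\mathbf r(N)$ and $\mathbf c(N)$ has property $A$, and let $p(A)$ be the probability that a uniformly random element of $\Omega_{\mathbf r(N),\mathbf c(N)}$ has property $A$. If $p'(A)=1-o(1)$ as $N\to\infty$, then $\Omega_{\mathbf r(N),\mathbf c(N)}$ is nonempty for all sufficiently large $N$ and $p(A)=1-o(1)$. -/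

import Mathlib

open Filter Topology Asymptotics

noncomputable section

/-- A bipartite multigraph with labelled parts `Fin m` and `Fin n`, given by its biadjacency table:
`adj i j` is the number of edges between vertex `i` of the first part and vertex `j` of the second.
The graph is simple when all entries are `0` or `1`. -/
structure BipartiteMultigraph where
  m : ℕ
  n : ℕ
  adj : Matrix (Fin m) (Fin n) ℕ

/-- `Ω_{r,c}`: the binary contingency tables with row sums `r` and column sums `c`. -/
def binaryTables {m n : ℕ} (r : Fin m → ℕ) (c : Fin n → ℕ) : Set (Matrix (Fin m) (Fin n) ℕ) :=
  {T | (∀ i j, T i j = 0 ∨ T i j = 1) ∧ (∀ i, ∑ j, T i j = r i) ∧ (∀ j, ∑ i, T i j = c j)}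

/-- The matchings between the type-1 tokens (`r i` of them for each row `i`) and the type-2 tokens
(`c j` of them for each column `j`). -/
abbrev TokenMatching {m n : ℕ} (r : Fin m → ℕ) (c : Fin n → ℕ) : Type :=
  (Σ i : Fin m, Fin (r i)) ≃ (Σ j : Fin n, Fin (c j))

/-- The table of a matching: entry `(i, j)` is the number of type-1 tokens from row `i` that are
matched to type-2 tokens from column `j`. -/
def TokenMatching.table {m n : ℕ} {r : Fin m → ℕ} {c : Fin n → ℕ} (σ : TokenMatching r c) :
    Matrix (Fin m) (Fin n) ℕ :=
  fun i j => (Finset.univ.filter fun t : Fin (r i) => (σ ⟨i, t⟩).1 = j).card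

/-- Probability that a uniformly random element of the finite set `s` satisfies `P`. -/
def uniformProb {α : Type*} (s : Set α) (P : α → Prop) : ℝ :=
  ({x ∈ s | P x}.ncard : ℝ) / (s.ncard : ℝ)

/-- `p(A)`: probability that a uniformly random graph from `Ω_{r,c}` has property `A`. -/
def uniformGraphProb {m n : ℕ} (r : Fin m → ℕ) (c : Fin n → ℕ)
    (A : BipartiteMultigraph → Prop) : ℝ :=
  uniformProb (binaryTables r c) fun T => A ⟨m, n, T⟩

/-- `p'(A)`: probability that the graph obtained from a uniformly random matching of the tokens
has property `A`. -/
def configurationProb {m n : ℕ} (r : Fin m → ℕ) (c : Fin n → ℕ)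
    (A : BipartiteMultigraph → Prop) : ℝ :=
  uniformProb (Set.univ : Set (TokenMatching r c)) fun σ => A ⟨m, n, σ.table⟩

/-- An input sequence `(r(N), c(N))_N`: for each `N`, nonincreasing vectors of nonnegative integers,
of lengths `m N` and `n N`, each with sum `N`.  (The index `0` carries only null vectors.) -/
structure InputSequence where
  m : ℕ → ℕ
  n : ℕ → ℕ
  r : (N : ℕ) → Fin (m N) → ℕ
  c : (N : ℕ) → Fin (n N) → ℕ
  r_antitone : ∀ N, Antitone (r N)
  c_antitone : ∀ N, Antitone (c N)
  sum_r : ∀ N, ∑ i, r N i = N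
  sum_c : ∀ N, ∑ j, c N j = N

namespace InputSequence

/-- `r_i(N)` with `i ≥ 1` (indexed from `1`), extended by `0` beyond the length of the vector. -/
def row (S : InputSequence) (N i : ℕ) : ℕ :=
  if h : 1 ≤ i ∧ i ≤ S.m N then S.r N ⟨i - 1, by omega⟩ else 0

/-- `c_j(N)` with `j ≥ 1` (indexed from `1`), extended by `0` beyond the length of the vector. -/
def col (S : InputSequence) (N j : ℕ) : ℕ :=
  if h : 1 ≤ j ∧ j ≤ S.n N then S.c N ⟨j - 1, by omega⟩ else 0

/-- `κ(S')` for the subsequence `S'` of `S` along the indices `N'(ℓ) = k ℓ`: the least `i ≥ 1` with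
`r'_i(ℓ) = o(N'(ℓ))`, and `∞` if there is none. -/
def kappa (S : InputSequence) (k : ℕ → ℕ) : ℕ∞ :=
  ⨅ i ∈ {i : ℕ | 1 ≤ i ∧ (fun ℓ => (S.row (k ℓ) i : ℝ)) =o[atTop] fun ℓ => (k ℓ : ℝ)}, (i : ℕ∞)

open Classical in
/-- `∑_{i ≥ κ(S')} r'_i(ℓ) / N'(ℓ)` for the subsequence `S'` of `S` along `k` (the terms with
`i > m` vanish; the sum is empty if `κ(S') = ∞`). -/
def tailFraction (S : InputSequence) (k : ℕ → ℕ) (ℓ : ℕ) : ℝ :=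
  ∑ i ∈ (Finset.Icc 1 (S.m (k ℓ))).filter (fun i : ℕ => S.kappa k ≤ (i : ℕ∞)),
    (S.row (k ℓ) i : ℝ) / (k ℓ : ℝ)

/-- `∑_i ∑_j r_i (r_i - 1) c_j (c_j - 1) = O(N ^ 2)`. -/
def Condition1 (S : InputSequence) : Prop :=
  (fun N : ℕ => ∑ i, ∑ j,
      (S.r N i : ℝ) * ((S.r N i : ℝ) - 1) * (S.c N j : ℝ) * ((S.c N j : ℝ) - 1))
    =O[atTop] fun N : ℕ => (N : ℝ) ^ 2

/-- For every subsequence `S'` of `S`,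
`limsup ∑_{i ≥ κ(S')} r'_i / N' > 0` or `limsup c'_1 < κ(S')`.
The first limsup is that of a sequence in `[0, 1]`; the second is taken in `ℕ∞`. -/
def Condition2 (S : InputSequence) : Prop :=
  ∀ k : ℕ → ℕ, StrictMono k →
    0 < limsup (fun ℓ => S.tailFraction k ℓ) atTop ∨
      limsup (fun ℓ => (S.col (k ℓ) 1 : ℕ∞)) atTop < S.kappa k

end InputSequence

end

/-! Every binary table is the table of the same number of token matchings, namely the row-preserving
permutations of the row tokens times those of the column tokens (`card_fiber`). So the configuration
model conditioned on simplicity is uniform on the binary tables, and if simplicity has probability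
at least `δ`, then `1 - p(A) ≤ (1 - p'(A)) / δ` (`one_sub_uniformGraphProb_le`). It remains to bound
the simplicity probability below for large `N`. Otherwise it tends to `0` along some subsequence, so
it is enough to find, on every subsequence, some `δ > 0` that is exceeded infinitely often.

Write `F = ∑ r_i(r_i-1)` and `G = ∑ c_j(c_j-1)`, so that Condition 1 reads `FG = O(N²)`. If `r_1 =
o(N)`, the lopsided local lemma is applied to the at most `FG` bad pairs of edges, each of
probability `1/(N(N-1))` (`le_card_avoiding`).

Otherwise `r_1 ≥ εN` on a further subsequence. Then `F` has order `N²` and `G` is bounded, so only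
boundedly many tokens lie in columns of degree at least two. These are placed greedily
(`pow_mul_card_equiv_le`). Condition 2 supplies the room: either the rows from `κ` on are
individually `o(N)` but jointly of order `N`, or the first `c_1` rows each have order `N` tokens. -/

/-! ### Permutations moving two prescribed points -/

section PairSwap

variable {V : Type*} [DecidableEq V]

/-- A permutation sending `v₁ ↦ w₁` and `v₂ ↦ w₂` (if `v₁ ≠ v₂`, `w₁ ≠ w₂`) that fixes every
other point. -/
def pairSwap (v₁ v₂ w₁ w₂ : V) : Equiv.Perm V :=
  (Equiv.swap v₁ w₁).trans (Equiv.swap (Equiv.swap v₁ w₁ v₂) w₂)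

lemma pairSwap_left {v₁ v₂ w₁ w₂ : V} (hv : v₁ ≠ v₂) (hw : w₁ ≠ w₂) :
    pairSwap v₁ v₂ w₁ w₂ v₁ = w₁ := by
  simp only [pairSwap, Equiv.trans_apply, Equiv.swap_apply_left]
  refine Equiv.swap_apply_of_ne_of_ne ?_ hw
  intro h
  apply hv
  apply (Equiv.swap v₁ w₁).injective
  simpa using h

lemma pairSwap_right (v₁ v₂ w₁ w₂ : V) : pairSwap v₁ v₂ w₁ w₂ v₂ = w₂ := by
  simp [pairSwap]

lemma pairSwap_of_ne {v₁ v₂ w₁ w₂ x : V} (h1 : x ≠ v₁) (h2 : x ≠ v₂) (h3 : x ≠ w₁)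
    (h4 : x ≠ w₂) : pairSwap v₁ v₂ w₁ w₂ x = x := by
  simp only [pairSwap, Equiv.trans_apply]
  rw [Equiv.swap_apply_of_ne_of_ne h1 h3, Equiv.swap_apply_of_ne_of_ne _ h4]
  rw [Equiv.swap_apply_def]
  split_ifs <;> assumption

end PairSwap

/-! ### Lopsided local lemma for random bijections -/

section LocalLemma

variable {U V : Type*} [Fintype U] [Fintype V] [DecidableEq U] [DecidableEq V]

/-- The bijection `σ` contains both edges `(q.1.1, q.2.1)` and `(q.1.2, q.2.2)`. -/
abbrev ContainsPair (σ : U ≃ V) (q : (U × U) × (V × V)) : Prop :=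
  σ q.1.1 = q.2.1 ∧ σ q.1.2 = q.2.2

/-- The pairs of edges `q` and `q'` have a common endpoint. -/
abbrev SharesEndpoint (q q' : (U × U) × (V × V)) : Prop :=
  ((q'.1.1 = q.1.1 ∨ q'.1.1 = q.1.2) ∨ (q'.1.2 = q.1.1 ∨ q'.1.2 = q.1.2)) ∨
    ((q'.2.1 = q.2.1 ∨ q'.2.1 = q.2.2) ∨ (q'.2.2 = q.2.1 ∨ q'.2.2 = q.2.2))

/-- The bijections containing none of the pairs of edges in `S`. -/
def avoiding (S : Finset ((U × U) × (V × V))) : Finset (U ≃ V) :=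
  Finset.univ.filter fun σ => ∀ q ∈ S, ¬ ContainsPair σ q

lemma mem_avoiding {S : Finset ((U × U) × (V × V))} {σ : U ≃ V} :
    σ ∈ avoiding S ↔ ∀ q ∈ S, ¬ ContainsPair σ q := by
  simp [avoiding]

lemma avoiding_subset {S T : Finset ((U × U) × (V × V))} (h : S ⊆ T) :
    avoiding T ⊆ avoiding S := fun σ hσ => by
  rw [mem_avoiding] at hσ ⊢
  exact fun q hq => hσ q (h hq)

/-- A pair of edges is negatively correlated with avoiding pairs that share no endpoint with it. -/
lemma card_containsPair_avoiding_le {q : (U × U) × (V × V)} (hu : q.1.1 ≠ q.1.2)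
    (hv : q.2.1 ≠ q.2.2) {S : Finset ((U × U) × (V × V))}
    (hS : ∀ q' ∈ S, ¬ SharesEndpoint q q') :
    ((avoiding S).filter fun σ => ContainsPair σ q).card *
      (Fintype.card V * Fintype.card V - Fintype.card V) ≤ (avoiding S).card := by
  obtain ⟨⟨u₁, u₂⟩, ⟨v₁, v₂⟩⟩ := q
  simp only at hu hv
  rw [← Finset.card_univ, ← Finset.offDiag_card, ← Finset.card_product]
  have key : ∀ (σ : U ≃ V) (w : V × V), σ u₁ = v₁ → σ u₂ = v₂ → w.1 ≠ w.2 →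
      (σ.trans (pairSwap v₁ v₂ w.1 w.2)) u₁ = w.1 ∧
      (σ.trans (pairSwap v₁ v₂ w.1 w.2)) u₂ = w.2 := by
    intro σ w h1 h2 hw
    simp only [Equiv.trans_apply, h1, h2]
    exact ⟨pairSwap_left hv hw, pairSwap_right _ _ _ _⟩
  -- Reroute `u₁, u₂` to an arbitrary ordered pair `w` of distinct points. The result determines `w`
  -- as the images of `u₁, u₂`, and hence `σ`.
  refine Finset.card_le_card_of_injOn
    (fun x : (U ≃ V) × (V × V) => x.1.trans (pairSwap v₁ v₂ x.2.1 x.2.2)) ?_ ?_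
  · rintro ⟨σ, w⟩ hx
    simp only [Finset.coe_product, Set.mem_prod, Finset.mem_coe, Finset.mem_filter,
      Finset.mem_offDiag, Finset.mem_univ, true_and] at hx
    obtain ⟨⟨hσ, h1, h2⟩, hw⟩ := hx
    obtain ⟨k1, k2⟩ := key σ w h1 h2 hw
    rw [mem_avoiding] at hσ
    simp only [Finset.mem_coe]
    rw [mem_avoiding]
    intro q' hq' hc
    have hs := hS q' hq'
    -- Rerouting creates no edge disjoint from `u₁, u₂, v₁, v₂`, so no pair of `S` can appear.
    have single : ∀ (u : U) (v : V), u ≠ u₁ → u ≠ u₂ → v ≠ v₁ → v ≠ v₂ →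
        (σ.trans (pairSwap v₁ v₂ w.1 w.2)) u = v → σ u = v := by
      intro u v a1 a2 b1 b2 huv
      have e1 : v ≠ w.1 := by
        rintro rfl
        exact a1 ((σ.trans (pairSwap v₁ v₂ w.1 w.2)).injective (huv.trans k1.symm))
      have e2 : v ≠ w.2 := by
        rintro rfl
        exact a2 ((σ.trans (pairSwap v₁ v₂ w.1 w.2)).injective (huv.trans k2.symm))
      have := pairSwap_of_ne b1 b2 e1 e2
      rw [Equiv.trans_apply] at huv
      exact (pairSwap v₁ v₂ w.1 w.2).injective (huv.trans this.symm)
    simp only [SharesEndpoint, not_or] at hs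
    exact hσ q' hq' ⟨single _ _ hs.1.1.1 hs.1.1.2 hs.2.1.1 hs.2.1.2 hc.1,
      single _ _ hs.1.2.1 hs.1.2.2 hs.2.2.1 hs.2.2.2 hc.2⟩
  · rintro ⟨σ, w⟩ hx ⟨σ', w'⟩ hx' heq
    simp only [Finset.coe_product, Set.mem_prod, Finset.mem_coe, Finset.mem_filter,
      Finset.mem_offDiag, Finset.mem_univ, true_and] at hx hx'
    obtain ⟨k1, k2⟩ := key σ w hx.1.2.1 hx.1.2.2 hx.2
    obtain ⟨k1', k2'⟩ := key σ' w' hx'.1.2.1 hx'.1.2.2 hx'.2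
    simp only at heq
    have hw : w = w' := by
      ext
      · rw [← k1, ← k1', heq]
      · rw [← k2, ← k2', heq]
    subst hw
    have : σ = σ' := by
      ext u
      have := congrArg (fun e : U ≃ V => e u) heq
      simpa using this
    rw [this]

/-- Conditional form of the lopsided local lemma for pairs of edges of a random bijection. -/
lemma card_containsPair_le {S₀ : Finset ((U × U) × (V × V))}
    (hne : ∀ q ∈ S₀, q.1.1 ≠ q.1.2 ∧ q.2.1 ≠ q.2.2) (d : ℕ)
    (hd : ∀ q ∈ S₀, (S₀.filter (SharesEndpoint q)).card ≤ d) {p : ℝ} (hp : 0 ≤ p)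
    (hpV : 1 ≤ p * (Fintype.card V * Fintype.card V - Fintype.card V : ℕ))
    (hpd : 4 * p * d ≤ 1) (S : Finset ((U × U) × (V × V))) :
    S ⊆ S₀ → ∀ q ∈ S₀, (((avoiding S).filter fun σ => ContainsPair σ q).card : ℝ) ≤
      2 * p * (avoiding S).card := by
  induction S using Finset.strongInduction with
  | H S ih =>
    intro hSS q hq
    -- `q` is controlled given avoidance of the far pairs `S₂`; restoring the at most `d` neighbours
    -- `S₁` costs only a factor 2.
    set S₁ := S.filter (SharesEndpoint q) with hS₁
    set S₂ := S.filter fun q' => ¬ SharesEndpoint q q' with hS₂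
    have h2 : S₂ ⊆ S := Finset.filter_subset _ _
    have hA : ((avoiding S₂).filter fun σ => ContainsPair σ q).card *
      (Fintype.card V * Fintype.card V - Fintype.card V) ≤ (avoiding S₂).card :=
      card_containsPair_avoiding_le (hne q hq).1 (hne q hq).2
        fun q' hq' => (Finset.mem_filter.1 hq').2
    have hA' : (((avoiding S₂).filter fun σ => ContainsPair σ q).card : ℝ) ≤
        p * (avoiding S₂).card := by
      have : ((((avoiding S₂).filter fun σ => ContainsPair σ q).card : ℝ) *
        (Fintype.card V * Fintype.card V - Fintype.card V : ℕ)) ≤ ((avoiding S₂).card : ℝ) := by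
        exact_mod_cast hA
      have h0 : (0 : ℝ) ≤ ((avoiding S₂).filter fun σ => ContainsPair σ q).card :=
        Nat.cast_nonneg _
      nlinarith [mul_le_mul_of_nonneg_left hpV h0, mul_le_mul_of_nonneg_left this hp]
    have hB : ∀ q' ∈ S₁, (((avoiding S₂).filter fun σ => ContainsPair σ q').card : ℝ) ≤
        2 * p * (avoiding S₂).card := by
      intro q' hq'
      rw [hS₁, Finset.mem_filter] at hq'
      refine ih S₂ ?_ (h2.trans hSS) q' (hSS hq'.1)
      -- The existence of `q' ∈ S₁` makes `S₂` strictly smaller, so induction applies.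
      refine Finset.ssubset_iff_subset_ne.2 ⟨h2, fun h => ?_⟩
      have := hq'.1
      rw [← h, hS₂, Finset.mem_filter] at this
      exact this.2 hq'.2
    have hcover : avoiding S₂ ⊆ avoiding S ∪
        S₁.biUnion fun q' => (avoiding S₂).filter fun σ => ContainsPair σ q' := by
      intro σ hσ
      by_cases h : σ ∈ avoiding S
      · exact Finset.mem_union_left _ h
      · rw [mem_avoiding] at h
        push Not at h
        obtain ⟨q', hq', hc⟩ := h
        refine Finset.mem_union_right _ (Finset.mem_biUnion.2 ⟨q', ?_, ?_⟩)
        · rw [hS₁, Finset.mem_filter]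
          refine ⟨hq', ?_⟩
          by_contra hn
          exact (mem_avoiding.1 hσ) q' (Finset.mem_filter.2 ⟨hq', hn⟩) hc
        · exact Finset.mem_filter.2 ⟨hσ, hc⟩
    have hC : ((avoiding S₂).card : ℝ) ≤ (avoiding S).card + d * (2 * p * (avoiding S₂).card) := by
      have c1 := (Finset.card_le_card hcover).trans (Finset.card_union_le _ _)
      have c2 : ((S₁.biUnion fun q' =>
          (avoiding S₂).filter fun σ => ContainsPair σ q').card : ℝ) ≤
          d * (2 * p * (avoiding S₂).card) := by
        calc _ ≤ ((∑ q' ∈ S₁, ((avoiding S₂).filter fun σ => ContainsPair σ q').card : ℕ) : ℝ) := by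
              exact_mod_cast Finset.card_biUnion_le
          _ ≤ ∑ q' ∈ S₁, 2 * p * ((avoiding S₂).card : ℝ) := by
              rw [Nat.cast_sum]
              exact Finset.sum_le_sum hB
          _ = S₁.card * (2 * p * (avoiding S₂).card) := by simp
          _ ≤ _ := by
              gcongr
              exact (Finset.card_le_card (Finset.filter_subset_filter _ hSS)).trans (hd q hq)
      have c3 : ((avoiding S₂).card : ℝ) ≤ (avoiding S).card + ((S₁.biUnion fun q' =>
          (avoiding S₂).filter fun σ => ContainsPair σ q').card : ℝ) := by exact_mod_cast c1
      linarith
    have hD : (((avoiding S).filter fun σ => ContainsPair σ q).card : ℝ) ≤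
        ((avoiding S₂).filter fun σ => ContainsPair σ q).card := by
      exact_mod_cast Finset.card_le_card (Finset.filter_subset_filter _ (avoiding_subset h2))
    have h0 : (0 : ℝ) ≤ (avoiding S₂).card := Nat.cast_nonneg _
    -- By `4pd ≤ 1`, the neighbours remove at most half of `avoiding S₂`.
    have hE : ((avoiding S₂).card : ℝ) ≤ 2 * (avoiding S).card := by
      nlinarith [mul_le_mul_of_nonneg_right hpd h0]
    nlinarith [mul_le_mul_of_nonneg_left hE hp]

/-- The lopsided local lemma for pairs of edges of a random bijection. -/
lemma le_card_avoiding {S₀ : Finset ((U × U) × (V × V))}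
    (hne : ∀ q ∈ S₀, q.1.1 ≠ q.1.2 ∧ q.2.1 ≠ q.2.2) (d : ℕ)
    (hd : ∀ q ∈ S₀, (S₀.filter (SharesEndpoint q)).card ≤ d) {p : ℝ} (hp : 0 ≤ p)
    (hp2 : 2 * p ≤ 1)
    (hpV : 1 ≤ p * (Fintype.card V * Fintype.card V - Fintype.card V : ℕ))
    (hpd : 4 * p * d ≤ 1) :
    (1 - 2 * p) ^ S₀.card * (Fintype.card (U ≃ V) : ℝ) ≤ (avoiding S₀).card := by
  suffices h : ∀ S : Finset ((U × U) × (V × V)), S ⊆ S₀ →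
      (1 - 2 * p) ^ S.card * (Fintype.card (U ≃ V) : ℝ) ≤ (avoiding S).card from h _ subset_rfl
  intro S
  induction S using Finset.induction_on with
  | empty => intro _; simp [avoiding]
  | insert q S hq ih =>
    intro hS
    have hSS := (Finset.subset_insert q S).trans hS
    -- Chain rule: each further pair keeps at least a fraction `1 - 2p`.
    have h1 := card_containsPair_le hne d hd hp hpV hpd S hSS q (hS (Finset.mem_insert_self _ _))
    have h2 := ih hSS
    have h3 : avoiding (insert q S) = (avoiding S).filter fun σ => ¬ ContainsPair σ q := by
      ext σ
      simp only [mem_avoiding, Finset.mem_filter, Finset.forall_mem_insert]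
      tauto
    have h4 := Finset.card_filter_add_card_filter_not (s := avoiding S)
      (fun σ => ContainsPair σ q)
    rw [← h3] at h4
    have h5 : (((avoiding S).filter fun σ => ContainsPair σ q).card : ℝ) +
      (avoiding (insert q S)).card = (avoiding S).card := by exact_mod_cast h4
    rw [Finset.card_insert_of_notMem hq, pow_succ]
    nlinarith [mul_le_mul_of_nonneg_left h2 (sub_nonneg.2 hp2)]

end LocalLemma

/-! ### Pairs of sibling tokens and the sparse bound -/

section Tokens

variable {m n : ℕ} {r : Fin m → ℕ} {c : Fin n → ℕ}

/-- No two tokens of the same row are matched to tokens of the same column. -/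
def IsSimpleMatching (σ : TokenMatching r c) : Prop :=
  ∀ x y, x ≠ y → x.1 = y.1 → (σ x).1 ≠ (σ y).1

/-- The number `∑ i, r i * (r i - 1)` of ordered pairs of distinct tokens in the same row. -/
def pairCount (r : Fin m → ℕ) : ℕ := ∑ i, (r i * r i - r i)

/-- The ordered pairs of distinct tokens in the same row. -/
def siblingPairs (r : Fin m → ℕ) : Finset ((Σ i, Fin (r i)) × (Σ i, Fin (r i))) :=
  (Finset.univ.sigma fun i => (Finset.univ : Finset (Fin (r i))).offDiag).image
    fun p => (⟨p.1, p.2.1⟩, ⟨p.1, p.2.2⟩)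

lemma card_siblingPairs_le : (siblingPairs r).card ≤ pairCount r := by
  refine Finset.card_image_le.trans ?_
  simp [pairCount, Finset.card_sigma, Finset.offDiag_card]

lemma mem_siblingPairs {x y : Σ i, Fin (r i)} :
    (x, y) ∈ siblingPairs r ↔ x ≠ y ∧ x.1 = y.1 := by
  obtain ⟨i, a⟩ := x
  obtain ⟨j, b⟩ := y
  simp only [siblingPairs, Finset.mem_image, Finset.mem_sigma, Finset.mem_univ, true_and,
    Finset.mem_offDiag, Prod.mk.injEq]
  constructor
  · rintro ⟨⟨k, s, t⟩, hne, h1, h2⟩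
    cases h1
    cases h2
    exact ⟨by simpa using hne, rfl⟩
  · rintro ⟨hne, h⟩
    cases h
    exact ⟨⟨i, a, b⟩, by simpa using hne, rfl, rfl⟩

lemma card_tokens_filter (P : Fin m → Prop) [DecidablePred P] :
    (Finset.univ.filter fun x : Σ i, Fin (r i) => P x.1).card =
      ∑ i ∈ Finset.univ.filter P, r i := by
  have : (Finset.univ.filter fun x : Σ i, Fin (r i) => P x.1) =
      (Finset.univ.filter P).sigma fun _ => Finset.univ := by
    ext x
    simp
  rw [this, Finset.card_sigma]
  simp

lemma card_tokens_row (i : Fin m) :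
    (Finset.univ.filter fun x : Σ i, Fin (r i) => x.1 = i).card = r i := by
  rw [card_tokens_filter (fun k => k = i), Finset.filter_eq']
  simp

lemma card_siblingPairs_fst_le {R : ℕ} (hR : ∀ i, r i ≤ R) (a : Σ i, Fin (r i)) :
    ((siblingPairs r).filter fun p => p.1 = a).card ≤ R := by
  refine le_trans ?_ ((card_tokens_row a.1).le.trans (hR a.1))
  refine Finset.card_le_card_of_injOn Prod.snd ?_ ?_
  · rintro ⟨x, y⟩ h
    simp only [Finset.coe_filter, Set.mem_ofPred_eq, mem_siblingPairs] at h
    simp only [Finset.coe_filter, Finset.mem_univ, true_and, Set.mem_ofPred_eq]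
    rw [← h.1.2, h.2]
  · rintro ⟨x, y⟩ h ⟨x', y'⟩ h' heq
    simp only [Finset.coe_filter, Set.mem_ofPred_eq] at h h' heq
    rw [h.2, h'.2, heq]

lemma card_siblingPairs_snd_le {R : ℕ} (hR : ∀ i, r i ≤ R) (a : Σ i, Fin (r i)) :
    ((siblingPairs r).filter fun p => p.2 = a).card ≤ R := by
  refine le_trans ?_ ((card_tokens_row a.1).le.trans (hR a.1))
  refine Finset.card_le_card_of_injOn Prod.fst ?_ ?_
  · rintro ⟨x, y⟩ h
    simp only [Finset.coe_filter, Set.mem_ofPred_eq, mem_siblingPairs] at h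
    simp only [Finset.coe_filter, Finset.mem_univ, true_and, Set.mem_ofPred_eq]
    rw [h.1.2, h.2]
  · rintro ⟨x, y⟩ h ⟨x', y'⟩ h' heq
    simp only [Finset.coe_filter, Set.mem_ofPred_eq] at h h' heq
    rw [h.2, h'.2, heq]

lemma card_siblingPairs_touching_le {R : ℕ} (hR : ∀ i, r i ≤ R) (a b : Σ i, Fin (r i)) :
    ((siblingPairs r).filter fun p =>
      (p.1 = a ∨ p.1 = b) ∨ (p.2 = a ∨ p.2 = b)).card ≤ 4 * R := by
  rw [Finset.filter_or, Finset.filter_or, Finset.filter_or]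
  refine (Finset.card_union_le _ _).trans ?_
  have h1 := Finset.card_union_le ((siblingPairs r).filter fun p => p.1 = a)
    ((siblingPairs r).filter fun p => p.1 = b)
  have h2 := Finset.card_union_le ((siblingPairs r).filter fun p => p.2 = a)
    ((siblingPairs r).filter fun p => p.2 = b)
  have := card_siblingPairs_fst_le hR a
  have := card_siblingPairs_fst_le hR b
  have := card_siblingPairs_snd_le hR a
  have := card_siblingPairs_snd_le hR b
  omega

/-- A shared row token leaves at most `4R` row pairs and any column pair; a shared column token is
symmetric. This bounds the degree of the dependency graph. -/
lemma card_sharesEndpoint_le {R K : ℕ} (hR : ∀ i, r i ≤ R) (hK : ∀ j, c j ≤ K)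
    (q : ((Σ i, Fin (r i)) × (Σ i, Fin (r i))) × ((Σ j, Fin (c j)) × (Σ j, Fin (c j)))) :
    ((siblingPairs r ×ˢ siblingPairs c).filter (SharesEndpoint q)).card ≤
      4 * (R * pairCount c + K * pairCount r) := by
  have hsub : (siblingPairs r ×ˢ siblingPairs c).filter (SharesEndpoint q) ⊆
      ((siblingPairs r).filter fun p =>
        (p.1 = q.1.1 ∨ p.1 = q.1.2) ∨ (p.2 = q.1.1 ∨ p.2 = q.1.2)) ×ˢ siblingPairs c ∪
      siblingPairs r ×ˢ ((siblingPairs c).filter fun p =>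
        (p.1 = q.2.1 ∨ p.1 = q.2.2) ∨ (p.2 = q.2.1 ∨ p.2 = q.2.2)) := by
    intro x hx
    simp only [Finset.mem_filter, Finset.mem_product, SharesEndpoint] at hx
    simp only [Finset.mem_union, Finset.mem_filter, Finset.mem_product]
    tauto
  refine (Finset.card_le_card hsub).trans ((Finset.card_union_le _ _).trans ?_)
  rw [Finset.card_product, Finset.card_product]
  have h1 := Nat.mul_le_mul (card_siblingPairs_touching_le hR q.1.1 q.1.2)
    (card_siblingPairs_le (r := c))
  have h2 := Nat.mul_le_mul (card_siblingPairs_le (r := r))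
    (card_siblingPairs_touching_le hK q.2.1 q.2.2)
  nlinarith

lemma isSimpleMatching_of_mem_avoiding {σ : TokenMatching r c}
    (h : σ ∈ avoiding (siblingPairs r ×ˢ siblingPairs c)) : IsSimpleMatching σ := by
  intro x y hxy hrow hcol
  refine (mem_avoiding.1 h) ((x, y), (σ x, σ y)) ?_ ⟨rfl, rfl⟩
  exact Finset.mem_product.2 ⟨mem_siblingPairs.2 ⟨hxy, hrow⟩,
    mem_siblingPairs.2 ⟨σ.injective.ne hxy, hcol⟩⟩

/-- On this range `1/(1-x) ≤ 1 + 2x ≤ exp(2x)`. -/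
lemma exp_neg_two_mul_le {x : ℝ} (h0 : 0 ≤ x) (h1 : x ≤ 1 / 2) : Real.exp (-(2 * x)) ≤ 1 - x := by
  rw [Real.exp_neg, inv_le_comm₀ (Real.exp_pos _) (by linarith)]
  refine le_trans ?_ (Real.add_one_le_exp (2 * x))
  rw [inv_le_iff_one_le_mul₀ (by linarith)]
  nlinarith

open Classical in
/-- If no row or column carries too many sibling pairs, a random matching is simple with
probability bounded below. -/
lemma le_card_isSimpleMatching {N R K : ℕ} (hc : ∑ j, c j = N) (hN : 3 ≤ N)
    (hR : ∀ i, r i ≤ R) (hK : ∀ j, c j ≤ K)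
    (hd : 16 * (R * pairCount c + K * pairCount r) ≤ N * N - N) {C : ℝ}
    (hC : (pairCount r * pairCount c : ℝ) ≤ C * (N * N - N : ℕ)) :
    Real.exp (-(4 * C)) * Fintype.card (TokenMatching r c) ≤
      ((Finset.univ.filter fun σ : TokenMatching r c => IsSimpleMatching σ).card : ℝ) := by
  have hcard : Fintype.card (Σ j, Fin (c j)) = N := by simp [hc]
  have hM : 6 ≤ N * N - N := by
    have : N * 3 ≤ N * N := Nat.mul_le_mul_left _ hN
    omega
  set M : ℕ := N * N - N with hMdef
  have hM' : (6 : ℝ) ≤ M := by exact_mod_cast hM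
  have hM0 : (0 : ℝ) < M := by linarith
  set p : ℝ := (M : ℝ)⁻¹ with hp
  have hp0 : 0 ≤ p := by positivity
  have hpM : p * M = 1 := inv_mul_cancel₀ hM0.ne'
  have hp4 : 2 * p ≤ 1 / 2 := by nlinarith
  set d : ℕ := 4 * (R * pairCount c + K * pairCount r) with hddef
  have hpd : 4 * p * d ≤ 1 := by
    have : (4 * d : ℝ) ≤ M := by
      have : 4 * d ≤ M := by omega
      exact_mod_cast this
    calc 4 * p * d = p * (4 * d) := by ring
      _ ≤ p * M := by gcongr
      _ = 1 := hpM
  have h := le_card_avoiding (S₀ := siblingPairs r ×ˢ siblingPairs c)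
    (by
      rintro ⟨⟨a, b⟩, ⟨a', b'⟩⟩ hq
      rw [Finset.mem_product] at hq
      exact ⟨(mem_siblingPairs.1 hq.1).1, (mem_siblingPairs.1 hq.2).1⟩)
    d (fun q _ => card_sharesEndpoint_le hR hK q) hp0 (by linarith)
    (by rw [hcard]; exact hpM.ge) hpd
  have hQ : ((siblingPairs r ×ˢ siblingPairs c).card : ℝ) ≤ C * M := by
    refine le_trans ?_ hC
    rw [Finset.card_product]
    exact_mod_cast Nat.mul_le_mul card_siblingPairs_le card_siblingPairs_le
  -- With `Q ≤ CM` bad pairs and `p = 1/M`, `(1-2p)^Q ≥ exp(-4pQ) ≥ exp(-4C)`.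
  have hexp : Real.exp (-(4 * C)) ≤ (1 - 2 * p) ^ (siblingPairs r ×ˢ siblingPairs c).card := by
    calc Real.exp (-(4 * C)) ≤
        Real.exp ((siblingPairs r ×ˢ siblingPairs c).card * (-(2 * (2 * p)))) := by
          apply Real.exp_le_exp.2
          have := mul_le_mul_of_nonneg_right hQ hp0
          have e : C * M * p = C := by rw [mul_assoc, mul_comm (M : ℝ), hpM, mul_one]
          rw [e] at this
          linarith
      _ = Real.exp (-(2 * (2 * p))) ^ (siblingPairs r ×ˢ siblingPairs c).card := by
          rw [Real.exp_nat_mul]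
      _ ≤ _ := pow_le_pow_left₀ (Real.exp_pos _).le
          (exp_neg_two_mul_le (by positivity) hp4) _
  refine (mul_le_mul_of_nonneg_right hexp (Nat.cast_nonneg _)).trans (h.trans ?_)
  refine Nat.cast_le.2 (Finset.card_le_card fun σ hσ => ?_)
  exact Finset.mem_filter.2 ⟨Finset.mem_univ _, isSimpleMatching_of_mem_avoiding hσ⟩

end Tokens

/-! ### Greedy placement in a random bijection -/

section Greedy

variable {U V α : Type*} [Fintype U] [Fintype V] [DecidableEq U] [DecidableEq V] [DecidableEq α]

open Classical in
/-- Greedy embedding: if every `v ∈ T` has many admissible images, then a random bijection maps the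
points of `T` to admissible images with distinct values of `g` with probability at least
`(L / |U|) ^ |T|`. -/
lemma pow_mul_card_equiv_le (g : U → α) (W : V → Finset U) (h L k : ℕ)
    (hW : ∀ v, ∀ a, ((W v).filter fun w => g w = a).card ≤ h) (T : Finset V)
    (hk : T.card ≤ k) (hL : ∀ v ∈ T, L + k * h ≤ (W v).card) :
    L ^ T.card * Fintype.card (V ≃ U) ≤ Fintype.card U ^ T.card *
      (Finset.univ.filter fun σ : V ≃ U =>
        (∀ v ∈ T, σ v ∈ W v) ∧ ∀ v ∈ T, ∀ v' ∈ T, g (σ v) = g (σ v') → v = v').card := by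
  induction T using Finset.induction_on with
  | empty => simp
  | insert v T hv ih =>
    rw [Finset.card_insert_of_notMem hv] at hk ⊢
    have ih := ih (by omega) fun w hw => hL w (Finset.mem_insert_of_mem hw)
    set G : Finset (V ≃ U) := Finset.univ.filter fun σ : V ≃ U =>
        (∀ v ∈ T, σ v ∈ W v) ∧ ∀ v ∈ T, ∀ v' ∈ T, g (σ v) = g (σ v') → v = v' with hG
    set G' : Finset (V ≃ U) := Finset.univ.filter fun σ : V ≃ U =>
        (∀ w ∈ insert v T, σ w ∈ W w) ∧
          ∀ w ∈ insert v T, ∀ w' ∈ insert v T, g (σ w) = g (σ w') → w = w' with hG'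
    -- The images still open to `v`: each point of `T` blocks at most `h` of them, so at least `L`
    -- remain.
    let free : (V ≃ U) → Finset U := fun σ => (W v).filter fun u => ∀ w ∈ T, g u ≠ g (σ w)
    have hfree : ∀ σ, L ≤ (free σ).card := by
      intro σ
      have h1 : W v ⊆ free σ ∪ T.biUnion fun w => (W v).filter fun u => g u = g (σ w) := by
        intro u hu
        by_cases hf : ∀ w ∈ T, g u ≠ g (σ w)
        · exact Finset.mem_union_left _ (Finset.mem_filter.2 ⟨hu, hf⟩)
        · push Not at hf
          obtain ⟨w, hw, hg⟩ := hf
          exact Finset.mem_union_right _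
            (Finset.mem_biUnion.2 ⟨w, hw, Finset.mem_filter.2 ⟨hu, hg⟩⟩)
      have h2 := (Finset.card_le_card h1).trans (Finset.card_union_le _ _)
      have h3 : (T.biUnion fun w => (W v).filter fun u => g u = g (σ w)).card ≤ T.card * h :=
        Finset.card_biUnion_le_card_mul _ _ _ fun w _ => hW v _
      have h4 := hL v (Finset.mem_insert_self _ _)
      have h5 : T.card * h ≤ k * h := Nat.mul_le_mul_right _ (by omega)
      omega
    -- Switching: send `(σ, u)` to the old value `σ v` and to `σ` followed by the swap of `σ v` with
    -- `u`. This leaves `T` undisturbed, and the recorded old value makes it injective.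
    have hstep : L * G.card ≤ Fintype.card U * G'.card := by
      calc L * G.card ≤ ∑ σ ∈ G, (free σ).card := by
            rw [mul_comm, ← smul_eq_mul]
            exact Finset.card_nsmul_le_sum _ _ _ fun σ _ => hfree σ
        _ = (G.sigma free).card := (Finset.card_sigma _ _).symm
        _ ≤ ((Finset.univ : Finset U) ×ˢ G').card := by
            have hfix : ∀ σ : V ≃ U, ∀ u ∈ free σ, ∀ w ∈ T,
                (σ.trans (Equiv.swap (σ v) u)) w = σ w := by
              intro σ u hu w hw
              rw [Equiv.trans_apply]
              refine Equiv.swap_apply_of_ne_of_ne ?_ ?_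
              · exact σ.injective.ne fun e => hv (e ▸ hw)
              · intro e
                exact (Finset.mem_filter.1 hu).2 w hw (congrArg g e.symm)
            have hnew : ∀ (σ : V ≃ U) (u : U), (σ.trans (Equiv.swap (σ v) u)) v = u := by
              intro σ u
              simp
            refine Finset.card_le_card_of_injOn
              (fun x : Σ _ : V ≃ U, U => (x.1 v, x.1.trans (Equiv.swap (x.1 v) x.2))) ?_ ?_
            · rintro ⟨σ, u⟩ hx
              simp only [Finset.coe_sigma, Set.mem_sigma_iff, Finset.mem_coe] at hx
              obtain ⟨hσ, hu⟩ := hx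
              rw [hG, Finset.mem_filter] at hσ
              have hu' := Finset.mem_filter.1 hu
              simp only [Finset.mem_coe, Finset.mem_product, Finset.mem_univ, true_and, hG',
                Finset.mem_filter]
              refine ⟨fun w hw => ?_, fun w hw w' hw' => ?_⟩
              · rcases Finset.mem_insert.1 hw with rfl | hw
                · rw [hnew]; exact hu'.1
                · rw [hfix σ u hu w hw]; exact hσ.2.1 w hw
              · rcases Finset.mem_insert.1 hw with rfl | hwT <;>
                  rcases Finset.mem_insert.1 hw' with rfl | hwT'
                · exact fun _ => rfl
                · rw [hnew, hfix σ u hu _ hwT']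
                  exact fun e => absurd e (hu'.2 _ hwT')
                · rw [hnew, hfix σ u hu _ hwT]
                  exact fun e => absurd e.symm (hu'.2 _ hwT)
                · rw [hfix σ u hu _ hwT, hfix σ u hu _ hwT']
                  exact hσ.2.2 w hwT w' hwT'
            · rintro ⟨σ, u⟩ hx ⟨σ', u'⟩ hx' heq
              simp only [Prod.mk.injEq] at heq
              obtain ⟨h1, h2⟩ := heq
              have e : u = u' := by rw [← hnew σ u, ← hnew σ' u', h2]
              subst e
              have : σ = σ' := by
                ext w
                have := congrArg (fun e : V ≃ U => e w) h2
                rw [h1] at this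
                simpa using this
              rw [this]
        _ = Fintype.card U * G'.card := by rw [Finset.card_product, Finset.card_univ]
    calc L ^ (T.card + 1) * Fintype.card (V ≃ U) = L * (L ^ T.card * Fintype.card (V ≃ U)) := by
          ring
      _ ≤ L * (Fintype.card U ^ T.card * G.card) := Nat.mul_le_mul_left _ ih
      _ = Fintype.card U ^ T.card * (L * G.card) := by ring
      _ ≤ Fintype.card U ^ T.card * (Fintype.card U * G'.card) := Nat.mul_le_mul_left _ hstep
      _ = _ := by ring

end Greedy

/-! ### Greedy placement of column tokens -/

section Tokens

variable {m n : ℕ} {r : Fin m → ℕ} {c : Fin n → ℕ}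

/-- `x ≤ x(x-1)` once `x ≥ 2`. -/
lemma card_tokens_two_le_le_pairCount :
    (Finset.univ.filter fun v : Σ j, Fin (c j) => 2 ≤ c v.1).card ≤ pairCount c := by
  rw [card_tokens_filter (fun j => 2 ≤ c j), pairCount]
  refine le_trans ?_ (Finset.sum_le_sum_of_subset (Finset.filter_subset (fun j => 2 ≤ c j) _))
  refine Finset.sum_le_sum fun j hj => ?_
  have h2 := (Finset.mem_filter.1 hj).2
  have := Nat.mul_le_mul_right (c j) h2
  omega

open Classical in
/-- Greedy lower bound for the probability of a simple matching, when the tokens `v` of the columns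
of size at least two can be sent to many tokens in `W v`. -/
lemma le_card_isSimpleMatching_of_greedy {α : Type*} [DecidableEq α] {N D h L : ℕ}
    (hr : ∑ i, r i = N)
    (hN : 0 < N) (hD : pairCount c ≤ D) (hLN : L ≤ N)
    (g : (Σ i, Fin (r i)) → α) (W : (Σ j, Fin (c j)) → Finset (Σ i, Fin (r i)))
    (hW : ∀ v, ∀ a, ((W v).filter fun w => g w = a).card ≤ h)
    (hL : ∀ v, 2 ≤ c v.1 → L + D * h ≤ (W v).card)
    (hg : ∀ v v' w w', v ≠ v' → v.1 = v'.1 → w ∈ W v → w' ∈ W v' → w.1 = w'.1 → g w = g w') :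
    ((L : ℝ) / N) ^ D * Fintype.card (TokenMatching r c) ≤
      ((Finset.univ.filter fun σ : TokenMatching r c => IsSimpleMatching σ).card : ℝ) := by
  set T := Finset.univ.filter fun v : Σ j, Fin (c j) => 2 ≤ c v.1 with hT
  have hTD : T.card ≤ D := card_tokens_two_le_le_pairCount.trans hD
  have key := pow_mul_card_equiv_le g W h L D hW T hTD
    (fun v hv => hL v (Finset.mem_filter.1 hv).2)
  have hU : Fintype.card (Σ i, Fin (r i)) = N := by simp [hr]
  have hsymm : Fintype.card ((Σ j, Fin (c j)) ≃ (Σ i, Fin (r i))) =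
      Fintype.card (TokenMatching r c) :=
    Fintype.card_congr ⟨Equiv.symm, Equiv.symm, fun e => rfl, fun e => rfl⟩
  rw [hU, hsymm] at key
  -- The greedy bijections run from column tokens to row tokens, hence the inverse. A repeated edge
  -- would give two tokens of one column, necessarily in `T`, equal values of `g`.
  have hle : (Finset.univ.filter fun σ : (Σ j, Fin (c j)) ≃ (Σ i, Fin (r i)) =>
        (∀ v ∈ T, σ v ∈ W v) ∧ ∀ v ∈ T, ∀ v' ∈ T, g (σ v) = g (σ v') → v = v').card ≤
      (Finset.univ.filter fun σ : TokenMatching r c => IsSimpleMatching σ).card := by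
    refine Finset.card_le_card_of_injOn Equiv.symm ?_ fun _ _ _ _ e => Equiv.symm_bijective.1 e
    intro σ hσ
    simp only [Finset.coe_filter, Finset.mem_univ, true_and, Set.mem_ofPred_eq] at hσ ⊢
    intro x y hxy hrow hcol
    have hne : σ.symm x ≠ σ.symm y := σ.symm.injective.ne hxy
    have h2 : 2 ≤ c (σ.symm x).1 := by
      have hpos : (σ.symm x).2.val < c (σ.symm x).1 := (σ.symm x).2.isLt
      by_contra hlt
      apply hne
      have h1 : c (σ.symm x).1 = 1 := by omega
      generalize σ.symm x = a at *
      generalize σ.symm y = b at *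
      obtain ⟨i, s⟩ := a
      obtain ⟨j, t⟩ := b
      cases hcol
      have hs := s.isLt
      have ht := t.isLt
      congr 1
      ext
      simp only at h1
      omega
    have hx : σ.symm x ∈ T := Finset.mem_filter.2 ⟨Finset.mem_univ _, h2⟩
    have hy : σ.symm y ∈ T := Finset.mem_filter.2 ⟨Finset.mem_univ _, hcol ▸ h2⟩
    refine hne (hσ.2 _ hx _ hy ?_)
    exact hg _ _ _ _ hne hcol (hσ.1 _ hx) (hσ.1 _ hy) (by simpa using hrow)
  have key2 : (L : ℝ) ^ T.card * Fintype.card (TokenMatching r c) ≤ (N : ℝ) ^ T.card *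
      (Finset.univ.filter fun σ : TokenMatching r c => IsSimpleMatching σ).card := by
    exact_mod_cast key.trans (Nat.mul_le_mul_left _ (by convert hle))
  have hN' : (0 : ℝ) < N := by exact_mod_cast hN
  have hpow : ((L : ℝ) / N) ^ D ≤ ((L : ℝ) / N) ^ T.card :=
    pow_le_pow_of_le_one (by positivity)
      ((div_le_one hN').2 (by exact_mod_cast hLN)) hTD
  refine (mul_le_mul_of_nonneg_right hpow (Nat.cast_nonneg _)).trans ?_
  rw [div_pow, div_mul_eq_mul_div, div_le_iff₀ (by positivity)]
  linarith

end Tokens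

/-! ### Labelings by tokens -/

section Labelings

variable {m : ℕ} {r : Fin m → ℕ}

/-- The bijections from the tokens to the domain of `f` that are compatible with the rows. -/
abbrev Labeling (r : Fin m → ℕ) {E : Type} (f : E → Fin m) : Type :=
  {α : (Σ i, Fin (r i)) ≃ E // ∀ u, f (α u) = u.1}

lemma nonempty_labeling {E : Type} [Fintype E] (f : E → Fin m)
    (hf : ∀ i, Fintype.card {e // f e = i} = r i) : Nonempty (Labeling r f) := by
  refine ⟨⟨(Equiv.sigmaCongrRight fun i =>
    (Fintype.equivFinOfCardEq (hf i)).symm).trans (Equiv.sigmaFiberEquiv f), ?_⟩⟩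
  rintro ⟨i, t⟩
  exact ((Fintype.equivFinOfCardEq (hf i)).symm t).2

/-- Two labelings differ by a row-preserving permutation of the tokens, so the count depends on `r`
alone. -/
lemma card_labeling {E : Type} [Fintype E] (f : E → Fin m)
    (hf : ∀ i, Fintype.card {e // f e = i} = r i) :
    Nat.card (Labeling r f) = Nat.card (Labeling r (Sigma.fst : (Σ i, Fin (r i)) → Fin m)) := by
  obtain ⟨α₀, h₀⟩ := nonempty_labeling f hf
  refine Nat.card_congr
    { toFun := fun α => ⟨α.1.trans α₀.symm, fun u => ?_⟩
      invFun := fun a => ⟨a.1.trans α₀, fun u => ?_⟩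
      left_inv := fun α => ?_
      right_inv := fun a => ?_ }
  · rw [← h₀, Equiv.trans_apply, Equiv.apply_symm_apply, α.2]
  · rw [Equiv.trans_apply, h₀, a.2]
  · ext u
    simp
  · apply Subtype.ext
    ext u : 1
    simp

end Labelings

/-! ### Fibres of the table map and transfer of probabilities -/

section Tables

variable {m n : ℕ} {r : Fin m → ℕ} {c : Fin n → ℕ}

lemma sum_table_row (σ : TokenMatching r c) (i : Fin m) : ∑ j, σ.table i j = r i := by
  have := Finset.card_eq_sum_card_fiberwise (s := (Finset.univ : Finset (Fin (r i))))
    (t := Finset.univ) (f := fun t => (σ ⟨i, t⟩).1) (fun _ _ => Finset.mem_coe.2 (Finset.mem_univ _))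
  rw [Finset.card_univ, Fintype.card_fin] at this
  exact this.symm

lemma sum_table_col (σ : TokenMatching r c) (j : Fin n) : ∑ i, σ.table i j = c j := by
  rw [← card_tokens_row (r := c) j]
  have : (Finset.univ.filter fun x : Σ i, Fin (r i) => (σ x).1 = j) =
      Finset.univ.sigma fun i => Finset.univ.filter fun t : Fin (r i) => (σ ⟨i, t⟩).1 = j := by
    ext x
    simp
  have h2 : (Finset.univ.filter fun x : Σ i, Fin (r i) => (σ x).1 = j).card =
      (Finset.univ.filter fun x : Σ j, Fin (c j) => x.1 = j).card :=
    Finset.card_bijective σ σ.bijective (by simp)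
  rw [← h2, this, Finset.card_sigma]
  rfl

lemma table_le_one_iff (σ : TokenMatching r c) :
    (∀ i j, σ.table i j = 0 ∨ σ.table i j = 1) ↔ IsSimpleMatching σ := by
  have h01 : ∀ i j, (σ.table i j = 0 ∨ σ.table i j = 1) ↔ σ.table i j ≤ 1 := by
    intro i j; omega
  simp only [h01]
  simp only [TokenMatching.table, Finset.card_le_one, Finset.mem_filter, Finset.mem_univ,
    true_and]
  constructor
  · rintro h ⟨i, s⟩ ⟨i', t⟩ hne hrow hcol
    cases hrow
    exact hne (by rw [h i _ s hcol t rfl])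
  · intro h i j s hs t ht
    by_contra hne
    exact h ⟨i, s⟩ ⟨i, t⟩ (by simpa using hne) rfl (hs.trans ht.symm)

lemma table_mem_binaryTables_iff (σ : TokenMatching r c) :
    σ.table ∈ binaryTables r c ↔ IsSimpleMatching σ := by
  rw [← table_le_one_iff]
  exact ⟨fun h => h.1, fun h => ⟨h, sum_table_row σ, sum_table_col σ⟩⟩

/-- The edges of the graph with biadjacency table `T`. -/
abbrev TableEdge (T : Matrix (Fin m) (Fin n) ℕ) : Type := {p : Fin m × Fin n // T p.1 p.2 = 1}

lemma card_tableEdge_row {T : Matrix (Fin m) (Fin n) ℕ} (hT : T ∈ binaryTables r c) (i : Fin m) :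
    Fintype.card {e : TableEdge T // e.1.1 = i} = r i := by
  rw [← hT.2.1 i]
  have h1 : ∑ j, T i j = (Finset.univ.filter fun j => T i j = 1).card := by
    rw [Finset.card_filter]
    refine Finset.sum_congr rfl fun j _ => ?_
    rcases hT.1 i j with h | h <;> simp [h]
  rw [h1, ← Fintype.card_subtype]
  refine Fintype.card_congr
    { toFun := fun e => ⟨e.1.1.2, by have := e.1.2; rwa [e.2] at this⟩
      invFun := fun j => ⟨⟨(i, j.1), j.2⟩, rfl⟩
      left_inv := ?_
      right_inv := fun _ => rfl }
  rintro ⟨⟨⟨i', j⟩, h⟩, rfl⟩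
  rfl

lemma card_tableEdge_col {T : Matrix (Fin m) (Fin n) ℕ} (hT : T ∈ binaryTables r c) (j : Fin n) :
    Fintype.card {e : TableEdge T // e.1.2 = j} = c j := by
  rw [← hT.2.2 j]
  have h1 : ∑ i, T i j = (Finset.univ.filter fun i => T i j = 1).card := by
    rw [Finset.card_filter]
    refine Finset.sum_congr rfl fun i _ => ?_
    rcases hT.1 i j with h | h <;> simp [h]
  rw [h1, ← Fintype.card_subtype]
  refine Fintype.card_congr
    { toFun := fun e => ⟨e.1.1.1, by have := e.1.2; rwa [e.2] at this⟩
      invFun := fun i => ⟨⟨(i.1, j), i.2⟩, rfl⟩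
      left_inv := ?_
      right_inv := fun _ => rfl }
  rintro ⟨⟨⟨i', j⟩, h⟩, rfl⟩
  rfl

lemma table_eq_one {T : Matrix (Fin m) (Fin n) ℕ} (hT : T ∈ binaryTables r c)
    {σ : TokenMatching r c} (hσ : σ.table = T) (u : Σ i, Fin (r i)) : T u.1 (σ u).1 = 1 := by
  refine (hT.1 _ _).resolve_left ?_
  rw [← hσ]
  exact Finset.card_ne_zero.2 ⟨u.2, by simp⟩

/-- The edges to which a matching with binary table `T` sends the row tokens. -/
noncomputable def rowLabeling {T : Matrix (Fin m) (Fin n) ℕ} (hT : T ∈ binaryTables r c)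
    {σ : TokenMatching r c} (hσ : σ.table = T) : (Σ i, Fin (r i)) ≃ TableEdge T :=
  Equiv.ofBijective (fun u => ⟨(u.1, (σ u).1), table_eq_one hT hσ u⟩) <| by
    constructor
    · intro u u' h
      simp only [Subtype.mk.injEq, Prod.mk.injEq] at h
      by_contra hne
      exact (table_mem_binaryTables_iff σ).1 (hσ ▸ hT) u u' hne h.1 h.2
    · rintro ⟨⟨i, j⟩, h⟩
      simp only at h
      have : (Finset.univ.filter fun t : Fin (r i) => (σ ⟨i, t⟩).1 = j).card ≠ 0 := by
        have : σ.table i j = 1 := by rw [hσ, h]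
        rw [TokenMatching.table] at this
        omega
      obtain ⟨t, ht⟩ := Finset.card_ne_zero.1 this
      refine ⟨⟨i, t⟩, ?_⟩
      simp only [Finset.mem_filter, Finset.mem_univ, true_and] at ht
      simp [ht]

lemma table_of_labelings {T : Matrix (Fin m) (Fin n) ℕ} (hT : T ∈ binaryTables r c)
    (α : Labeling r fun e : TableEdge T => e.1.1) (β : Labeling c fun e : TableEdge T => e.1.2) :
    TokenMatching.table (α.1.trans β.1.symm) = T := by
  ext i j
  have hcol : ∀ u, ((α.1.trans β.1.symm) u).1 = (α.1 u).1.2 := by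
    intro u
    rw [← β.2, Equiv.trans_apply, Equiv.apply_symm_apply]
  have hrow : ∀ u, (α.1 u).1.1 = u.1 := α.2
  simp only [TokenMatching.table, hcol]
  rcases hT.1 i j with h | h
  · rw [h, Finset.card_eq_zero, Finset.filter_eq_empty_iff]
    intro t _ ht
    have h1 := (α.1 ⟨i, t⟩).2
    rw [ht, hrow, h] at h1
    exact zero_ne_one h1
  · rw [h, Finset.card_eq_one]
    obtain ⟨⟨i', t⟩, ht⟩ := α.1.surjective ⟨(i, j), h⟩
    have hi := hrow ⟨i', t⟩
    rw [ht] at hi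
    simp only at hi
    subst hi
    refine ⟨t, ?_⟩
    ext s
    simp only [Finset.mem_filter, Finset.mem_univ, true_and, Finset.mem_singleton]
    constructor
    · intro hs
      have : α.1 ⟨i, s⟩ = α.1 ⟨i, t⟩ := by
        rw [ht]
        apply Subtype.ext
        exact Prod.ext (hrow ⟨i, s⟩) hs
      simpa using α.1.injective this
    · rintro rfl
      rw [ht]

/-- Matchings with a given binary table correspond to labelings of its edges by row tokens and by
column tokens. -/
noncomputable def fiberEquiv {T : Matrix (Fin m) (Fin n) ℕ} (hT : T ∈ binaryTables r c) :
    {σ : TokenMatching r c // σ.table = T} ≃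
      Labeling r (fun e : TableEdge T => e.1.1) × Labeling c (fun e : TableEdge T => e.1.2) where
  toFun σ := (⟨rowLabeling hT σ.2, fun _ => rfl⟩,
    ⟨σ.1.symm.trans (rowLabeling hT σ.2), fun v => by
      change (σ.1 (σ.1.symm v)).1 = v.1
      rw [Equiv.apply_symm_apply]⟩)
  invFun x := ⟨x.1.1.trans x.2.1.symm, table_of_labelings hT x.1 x.2⟩
  left_inv σ := by
    apply Subtype.ext
    ext u : 1
    simp
  right_inv x := by
    obtain ⟨α, β⟩ := x
    have h : ∀ u, rowLabeling hT (table_of_labelings hT α β) u = α.1 u := by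
      intro u
      apply Subtype.ext
      refine Prod.ext (α.2 u).symm ?_
      change (β.1.symm (α.1 u)).1 = _
      rw [← β.2, Equiv.apply_symm_apply]
    refine Prod.ext (Subtype.ext (Equiv.ext h)) (Subtype.ext (Equiv.ext fun v => ?_))
    simp [h]

/-- The number of matchings with a given binary table. -/
noncomputable def fiberCard (r : Fin m → ℕ) (c : Fin n → ℕ) : ℕ :=
  Nat.card (Labeling r (Sigma.fst : (Σ i, Fin (r i)) → Fin m)) *
    Nat.card (Labeling c (Sigma.fst : (Σ j, Fin (c j)) → Fin n))

lemma fiberCard_pos (r : Fin m → ℕ) (c : Fin n → ℕ) : 0 < fiberCard r c := by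
  have h1 : Nonempty (Labeling r (Sigma.fst : (Σ i, Fin (r i)) → Fin m)) :=
    ⟨⟨Equiv.refl _, fun _ => rfl⟩⟩
  have h2 : Nonempty (Labeling c (Sigma.fst : (Σ j, Fin (c j)) → Fin n)) :=
    ⟨⟨Equiv.refl _, fun _ => rfl⟩⟩
  exact Nat.mul_pos Nat.card_pos Nat.card_pos

lemma card_fiber {T : Matrix (Fin m) (Fin n) ℕ} (hT : T ∈ binaryTables r c) :
    Nat.card {σ : TokenMatching r c // σ.table = T} = fiberCard r c := by
  rw [Nat.card_congr (fiberEquiv hT), Nat.card_prod, card_labeling _ (card_tableEdge_row hT),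
    card_labeling _ (card_tableEdge_col hT), fiberCard]

/-- Fibres have positive size, so every binary table comes from one of the finitely many matchings.
-/
lemma finite_binaryTables : (binaryTables r c).Finite := by
  refine (Set.finite_range (TokenMatching.table (r := r) (c := c))).subset fun T hT => ?_
  have : Nonempty {σ : TokenMatching r c // σ.table = T} := by
    rw [← not_isEmpty_iff]
    intro h
    have := card_fiber hT
    rw [Nat.card_of_isEmpty] at this
    exact (fiberCard_pos r c).ne this
  obtain ⟨σ, hσ⟩ := this
  exact ⟨σ, hσ⟩

lemma ncard_table_preimage {B : Set (Matrix (Fin m) (Fin n) ℕ)} (hB : B ⊆ binaryTables r c) :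
    {σ : TokenMatching r c | σ.table ∈ B}.ncard = fiberCard r c * B.ncard := by
  classical
  lift B to Finset (Matrix (Fin m) (Fin n) ℕ) using finite_binaryTables.subset hB
  rw [Set.ncard_coe_finset, Set.ncard_eq_toFinset_card',
    Finset.card_eq_sum_card_fiberwise (f := TokenMatching.table) (t := B) (by
      intro σ hσ
      simpa using hσ), mul_comm, ← smul_eq_mul]
  refine Finset.sum_const_nat fun T hT => ?_
  rw [← card_fiber (hB (Finset.mem_coe.2 hT)), Nat.card_eq_fintype_card, Fintype.card_subtype]
  congr 1
  ext σ
  simp only [Finset.mem_filter, Set.mem_toFinset, Set.mem_ofPred_eq, Finset.mem_coe,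
    Finset.mem_univ, true_and, and_iff_right_iff_imp]
  rintro rfl
  exact hT

/-- Fraction of the complementary event under a uniform distribution. -/
lemma one_sub_uniformProb {α : Type*} {s : Set α} (hs : s.Finite) (hne : s.Nonempty)
    (P : α → Prop) : 1 - uniformProb s P = uniformProb s fun x => ¬ P x := by
  have h0 : (s.ncard : ℝ) ≠ 0 := by
    have := (Set.ncard_pos hs).2 hne
    positivity
  have h1 : ({x ∈ s | P x}.ncard : ℝ) + ({x ∈ s | ¬ P x}.ncard : ℝ) = s.ncard := by
    rw [← Nat.cast_add, ← Set.ncard_union_eq _ (hs.subset (Set.sep_subset _ _))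
      (hs.subset (Set.sep_subset _ _))]
    · congr 2
      ext x
      simp only [Set.mem_union, Set.mem_ofPred_eq]
      tauto
    · rw [Set.disjoint_left]
      rintro x hx hx'
      exact hx'.2 hx.2
  rw [uniformProb, uniformProb, ← h1, eq_div_iff (by rwa [h1]), sub_mul, one_mul,
    div_mul_cancel₀ _ (by rwa [h1])]
  ring

lemma uniformProb_nonneg {α : Type*} (s : Set α) (P : α → Prop) : 0 ≤ uniformProb s P :=
  div_nonneg (Nat.cast_nonneg _) (Nat.cast_nonneg _)

open Classical in
/-- Transfer from the configuration model to uniformly random graphs. -/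
lemma one_sub_uniformGraphProb_le {δ : ℝ} (hδ : 0 < δ) (hne : Nonempty (TokenMatching r c))
    (h : δ * Fintype.card (TokenMatching r c) ≤
      ((Finset.univ.filter fun σ : TokenMatching r c => IsSimpleMatching σ).card : ℝ))
    (A : BipartiteMultigraph → Prop) :
    (binaryTables r c).Nonempty ∧ uniformGraphProb r c A ≤ 1 ∧
      1 - uniformGraphProb r c A ≤ (1 - configurationProb r c A) / δ := by
  have hM : (0 : ℝ) < Fintype.card (TokenMatching r c) := by exact_mod_cast Fintype.card_pos
  have hsimple : {σ : TokenMatching r c | σ.table ∈ binaryTables r c}.ncard =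
      (Finset.univ.filter fun σ : TokenMatching r c => IsSimpleMatching σ).card := by
    rw [Set.ncard_eq_toFinset_card']
    congr 1
    ext σ
    simp [table_mem_binaryTables_iff]
  -- The simplicity bound now bounds `fiberCard * |Ω|` below; in particular `Ω` is nonempty.
  rw [← hsimple, ncard_table_preimage subset_rfl, Nat.cast_mul] at h
  have hk : (0 : ℝ) < fiberCard r c := by exact_mod_cast fiberCard_pos r c
  have hpos : (0 : ℝ) < fiberCard r c * (binaryTables r c).ncard := lt_of_lt_of_le (by positivity) h
  have hΩ : (0 : ℝ) < (binaryTables r c).ncard := pos_of_mul_pos_right hpos hk.le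
  have hΩne : (binaryTables r c).Nonempty := by
    rw [← Set.ncard_pos finite_binaryTables]
    exact_mod_cast hΩ
  have e := one_sub_uniformProb finite_binaryTables hΩne
    (fun T : Matrix (Fin m) (Fin n) ℕ => A ⟨m, n, T⟩)
  have e' := one_sub_uniformProb (Set.finite_univ (α := TokenMatching r c)) Set.univ_nonempty
    (fun σ => A ⟨m, n, σ.table⟩)
  rw [uniformGraphProb, configurationProb, e']
  have hle : uniformProb (binaryTables r c) (fun T => A ⟨m, n, T⟩) ≤ 1 := by
    have := uniformProb_nonneg (binaryTables r c)
      fun T : Matrix (Fin m) (Fin n) ℕ => ¬ A ⟨m, n, T⟩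
    linarith
  refine ⟨hΩne, hle, ?_⟩
  rw [e, uniformProb, uniformProb, Set.ncard_univ, Nat.card_eq_fintype_card, div_div,
    div_le_div_iff₀ hΩ (by positivity)]
  have hpre := ncard_table_preimage (r := r) (c := c)
    (B := {T ∈ binaryTables r c | ¬ A ⟨m, n, T⟩}) (Set.sep_subset _ _)
  have hsub : {σ : TokenMatching r c | σ.table ∈ {T ∈ binaryTables r c | ¬ A ⟨m, n, T⟩}}.ncard ≤
      {σ ∈ (Set.univ : Set (TokenMatching r c)) | ¬ A ⟨m, n, σ.table⟩}.ncard :=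
    Set.ncard_le_ncard (fun σ hσ => ⟨Set.mem_univ _, hσ.2⟩) (Set.toFinite _)
  rw [hpre] at hsub
  have hsub' : (fiberCard r c : ℝ) * ({T ∈ binaryTables r c | ¬ A ⟨m, n, T⟩}.ncard : ℝ) ≤
      {σ ∈ (Set.univ : Set (TokenMatching r c)) | ¬ A ⟨m, n, σ.table⟩}.ncard := by
    exact_mod_cast hsub
  have hx : (0 : ℝ) ≤ ({T ∈ binaryTables r c | ¬ A ⟨m, n, T⟩}.ncard : ℝ) := Nat.cast_nonneg _
  calc _ ≤ ({T ∈ binaryTables r c | ¬ A ⟨m, n, T⟩}.ncard : ℝ) *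
        (fiberCard r c * (binaryTables r c).ncard) := by
        rw [mul_comm (Fintype.card (TokenMatching r c) : ℝ)]
        gcongr
    _ = (fiberCard r c * ({T ∈ binaryTables r c | ¬ A ⟨m, n, T⟩}.ncard : ℝ)) *
        (binaryTables r c).ncard := by ring
    _ ≤ _ := by gcongr

end Tables

/-! ### Numerical criteria for simplicity -/

section SufficientConditions

variable {m n : ℕ} {r : Fin m → ℕ} {c : Fin n → ℕ}

lemma pairCount_le_mul {N R : ℕ} (hr : ∑ i, r i = N) (hR : ∀ i, r i ≤ R) :
    pairCount r ≤ R * N := by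
  rw [← hr, Finset.mul_sum]
  exact Finset.sum_le_sum fun i _ =>
    (Nat.sub_le _ _).trans (Nat.mul_le_mul_right _ (hR i))

lemma mul_self_sub_le_pairCount (i : Fin m) : r i * r i - r i ≤ pairCount r :=
  Finset.single_le_sum (f := fun i => r i * r i - r i) (fun _ _ => Nat.zero_le _)
    (Finset.mem_univ i)

lemma cast_pairCount : (pairCount r : ℝ) = ∑ i, (r i : ℝ) * ((r i : ℝ) - 1) := by
  rw [pairCount, Nat.cast_sum]
  refine Finset.sum_congr rfl fun i _ => ?_
  rw [Nat.cast_sub (Nat.le_mul_self _)]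
  push_cast
  ring

/-- A single large degree already gives `F ≥ R(R-1) ≥ 64CR`, so `RG` is at most `FG/(64C)`. -/
lemma mul_le_sq_of_mul_le {R F G N C : ℕ} (hC : 1 ≤ C) (hR : R * R - R ≤ F)
    (h : F * G ≤ C * (N * N)) (hRC : 64 * C + 1 ≤ R) : 64 * (R * G) ≤ N * N := by
  have h1 : R * (64 * C) ≤ F := by
    refine le_trans ?_ hR
    have := Nat.mul_le_mul_left R hRC
    have h2 : R * (64 * C + 1) = R * (64 * C) + R := by ring
    omega
  have h2 : C * (64 * (R * G)) ≤ C * (N * N) := by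
    calc C * (64 * (R * G)) = R * (64 * C) * G := by ring
      _ ≤ F * G := Nat.mul_le_mul_right _ h1
      _ ≤ _ := h
  exact Nat.le_of_mul_le_mul_left h2 hC

open Classical in
/-- Sparse degrees: the largest degrees are small compared with the number of edges. -/
lemma le_card_isSimpleMatching_of_sparse {N R K C : ℕ} (hr : ∑ i, r i = N) (hc : ∑ j, c j = N)
    (hR : ∀ i, r i ≤ R) (hK : ∀ j, c j ≤ K) (hKR : K ≤ R) (hR' : R * R - R ≤ pairCount r)
    (hK' : K * K - K ≤ pairCount c) (hC : 1 ≤ C)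
    (h : pairCount r * pairCount c ≤ C * (N * N)) (hRN : 4096 * C * R ≤ N)
    (hN : 64 * (64 * C) ^ 2 ≤ N) :
    Real.exp (-(4 * (2 * C))) * Fintype.card (TokenMatching r c) ≤
      ((Finset.univ.filter fun σ : TokenMatching r c => IsSimpleMatching σ).card : ℝ) := by
  have hC2 : 1 ≤ (64 * C) ^ 2 := Nat.one_le_pow _ _ (by omega)
  have hN3 : 3 ≤ N := by omega
  -- Bounding each dependency term by `N²/64` gives `16 · 2 · N²/64 = N²/2 ≤ N² - N`.
  have h1 : 64 * (R * pairCount c) ≤ N * N := by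
    by_cases hRC : 64 * C + 1 ≤ R
    · exact mul_le_sq_of_mul_le hC hR' h hRC
    · have hR1 : R ≤ 64 * C := by omega
      calc 64 * (R * pairCount c) ≤ 64 * ((64 * C) * ((64 * C) * N)) := by
            gcongr
            exact (pairCount_le_mul hc hK).trans (Nat.mul_le_mul_right _ (hKR.trans hR1))
        _ = 64 * (64 * C) ^ 2 * N := by ring
        _ ≤ N * N := Nat.mul_le_mul_right _ hN
  have h2 : 64 * (K * pairCount r) ≤ N * N := by
    by_cases hKC : 64 * C + 1 ≤ K
    · exact mul_le_sq_of_mul_le hC hK' (by rwa [mul_comm]) hKC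
    -- Here `R` may be unbounded; its smallness relative to `N` compensates.
    · calc 64 * (K * pairCount r) ≤ 64 * ((64 * C) * (R * N)) := by
            gcongr
            · omega
            · exact pairCount_le_mul hr hR
        _ = 4096 * C * R * N := by ring
        _ ≤ N * N := Nat.mul_le_mul_right _ hRN
  have hNN : 3 * N ≤ N * N := Nat.mul_le_mul_right _ hN3
  refine le_card_isSimpleMatching hc hN3 hR hK (by omega) ?_
  have : C * (N * N) ≤ 2 * C * (N * N - N) := by
    rw [mul_comm 2 C, mul_assoc]
    exact Nat.mul_le_mul_left _ (by omega)
  exact_mod_cast h.trans this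

open Classical in
/-- Real form of the greedy lower bound. -/
lemma pow_mul_card_le_card_isSimpleMatching {α : Type*} [DecidableEq α] {N D h : ℕ} {ε : ℝ}
    (hr : ∑ i, r i = N)
    (hε : 0 < ε) (hε1 : ε ≤ 1) (hN : 4 ≤ ε * N) (hD : pairCount c ≤ D)
    (hDh : (D * h : ℝ) ≤ ε * N / 2)
    (g : (Σ i, Fin (r i)) → α) (W : (Σ j, Fin (c j)) → Finset (Σ i, Fin (r i)))
    (hW : ∀ v, ∀ a, ((W v).filter fun w => g w = a).card ≤ h)
    (hL : ∀ v, ε * N ≤ (W v).card)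
    (hg : ∀ v v' w w', v ≠ v' → v.1 = v'.1 → w ∈ W v → w' ∈ W v' → w.1 = w'.1 → g w = g w') :
    (ε / 4) ^ D * Fintype.card (TokenMatching r c) ≤
      ((Finset.univ.filter fun σ : TokenMatching r c => IsSimpleMatching σ).card : ℝ) := by
  have hN0 : (0 : ℝ) < N := by
    by_contra hneg
    have : ε * N ≤ 0 := mul_nonpos_of_nonneg_of_nonpos hε.le (not_lt.1 hneg)
    linarith
  have hfl : (⌊ε * N / 2⌋₊ : ℝ) ≤ ε * N / 2 := Nat.floor_le (by positivity)
  have hfl' : ε * N / 2 < ⌊ε * N / 2⌋₊ + 1 := Nat.lt_floor_add_one _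
  refine le_trans ?_ (le_card_isSimpleMatching_of_greedy (N := N) (D := D) (h := h)
    (L := ⌊ε * N / 2⌋₊) hr (by exact_mod_cast hN0) hD ?_ g W hW ?_ hg)
  -- Half of the room `εN` is reserved for blocked images, half for `L`; the floor loses at most 1,
  -- which is at most `εN/4`.
  · have : ε / 4 ≤ (⌊ε * N / 2⌋₊ : ℝ) / N := by
      rw [div_le_div_iff₀ (by norm_num) hN0]
      linarith
    gcongr
  · have : (⌊ε * N / 2⌋₊ : ℝ) ≤ N := by nlinarith
    exact_mod_cast this
  · intro v _
    have : ((⌊ε * N / 2⌋₊ + D * h : ℕ) : ℝ) ≤ (W v).card := by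
      push_cast
      linarith [hL v]
    exact_mod_cast this

end SufficientConditions

/-! ### Degree sequences and the two conditions -/

namespace InputSequence

variable (S : InputSequence)

lemma row_succ (N : ℕ) (i : Fin (S.m N)) : S.row N (i + 1) = S.r N i := by
  have : 1 ≤ i.val + 1 ∧ i.val + 1 ≤ S.m N := ⟨by omega, i.isLt⟩
  simp [row, this]

lemma row_anti (N : ℕ) {i i' : ℕ} (hi : 1 ≤ i) (h : i ≤ i') : S.row N i' ≤ S.row N i := by
  unfold row
  split_ifs with h1 h2 h2
  · exact S.r_antitone N (Fin.mk_le_mk.2 (by omega))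
  · omega
  · exact Nat.zero_le _
  · exact le_rfl

lemma r_le_row_one (N : ℕ) (i : Fin (S.m N)) : S.r N i ≤ S.row N 1 := by
  rw [← row_succ]
  exact S.row_anti N le_rfl (by omega)

lemma c_le_col_one (N : ℕ) (j : Fin (S.n N)) : S.c N j ≤ S.col N 1 := by
  have : 1 ≤ 1 ∧ 1 ≤ S.n N := ⟨le_rfl, by have := j.isLt; omega⟩
  rw [col, dif_pos this]
  exact S.c_antitone N (Fin.mk_le_mk.2 (Nat.zero_le _))

lemma row_one_sq_le (N : ℕ) : S.row N 1 * S.row N 1 - S.row N 1 ≤ pairCount (S.r N) := by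
  unfold row
  split_ifs
  · exact mul_self_sub_le_pairCount _
  · simp

lemma col_one_sq_le (N : ℕ) : S.col N 1 * S.col N 1 - S.col N 1 ≤ pairCount (S.c N) := by
  unfold col
  split_ifs
  · exact mul_self_sub_le_pairCount _
  · simp

lemma sum_row_filter (N : ℕ) (p : ℕ → Prop) [DecidablePred p] :
    ∑ i ∈ (Finset.Icc 1 (S.m N)).filter p, S.row N i =
      ∑ i ∈ Finset.univ.filter (fun i : Fin (S.m N) => p (i + 1)), S.r N i := by
  symm
  refine Finset.sum_bij (fun i _ => i.val + 1) ?_ ?_ ?_ ?_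
  · intro i hi
    have := i.isLt
    simp only [Finset.mem_filter, Finset.mem_univ, true_and, Finset.mem_Icc] at hi ⊢
    exact ⟨⟨by omega, by omega⟩, hi⟩
  · intro i _ i' _ h
    exact Fin.ext (by simpa using h)
  · intro i hi
    simp only [Finset.mem_filter, Finset.mem_Icc] at hi
    obtain ⟨⟨h1, h2⟩, hp⟩ := hi
    refine ⟨⟨i - 1, by omega⟩, ?_, ?_⟩
    · simp only [Finset.mem_filter, Finset.mem_univ, true_and]
      rwa [Nat.sub_add_cancel h1]
    · exact Nat.sub_add_cancel h1
  · intro i _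
    rw [row_succ]

variable {S}

/-- The double sum factors into the two pair counts. -/
lemma Condition1.exists_bound (h1 : S.Condition1) : ∃ C : ℕ, 1 ≤ C ∧
    ∀ᶠ N in atTop, pairCount (S.r N) * pairCount (S.c N) ≤ C * (N * N) := by
  obtain ⟨C, hC⟩ := h1.bound
  refine ⟨⌈C⌉₊ + 1, by omega, ?_⟩
  filter_upwards [hC] with N hN
  have e : (∑ i, ∑ j, (S.r N i : ℝ) * ((S.r N i : ℝ) - 1) * (S.c N j : ℝ) *
      ((S.c N j : ℝ) - 1)) = (pairCount (S.r N) : ℝ) * pairCount (S.c N) := by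
    rw [cast_pairCount, cast_pairCount, Finset.sum_mul_sum]
    refine Finset.sum_congr rfl fun i _ => Finset.sum_congr rfl fun j _ => ?_
    ring
  rw [e, Real.norm_of_nonneg (by positivity), Real.norm_of_nonneg (by positivity)] at hN
  have h2 : C * (N : ℝ) ^ 2 ≤ ((⌈C⌉₊ + 1 : ℕ) : ℝ) * (N * N) := by
    rw [sq]
    gcongr
    push_cast
    linarith [Nat.le_ceil C]
  exact_mod_cast hN.trans h2

lemma exists_frequently_of_not_isLittleO {f g : ℕ → ℕ}
    (h : ¬ (fun l => (f l : ℝ)) =o[atTop] fun l => (g l : ℝ)) :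
    ∃ ε : ℝ, 0 < ε ∧ ε ≤ 1 ∧ ∃ᶠ l in atTop, ε * g l ≤ f l := by
  rw [isLittleO_iff] at h
  push Not at h
  obtain ⟨ε, hε, hf⟩ := h
  refine ⟨min ε 1, lt_min hε one_pos, min_le_right _ _, hf.mono fun l hl => ?_⟩
  rw [Real.norm_of_nonneg (Nat.cast_nonneg _), Real.norm_of_nonneg (Nat.cast_nonneg _)] at hl
  exact (mul_le_mul_of_nonneg_right (min_le_left _ _) (Nat.cast_nonneg _)).trans hl.le

lemma kappa_le {k : ℕ → ℕ} {i : ℕ} (hi : 1 ≤ i)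
    (h : (fun l => (S.row (k l) i : ℝ)) =o[atTop] fun l => (k l : ℝ)) : S.kappa k ≤ i :=
  iInf₂_le i ⟨hi, h⟩

/-- A finite infimum of naturals in `ℕ∞` is attained. -/
lemma kappa_spec {k : ℕ → ℕ} {i : ℕ} (h : S.kappa k = i) :
    1 ≤ i ∧ (fun l => (S.row (k l) i : ℝ)) =o[atTop] fun l => (k l : ℝ) := by
  have hlt : S.kappa k < (i + 1 : ℕ) := by
    rw [h]
    exact_mod_cast Nat.lt_succ_self i
  rw [kappa] at hlt
  simp only [iInf_lt_iff] at hlt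
  obtain ⟨i', hi', hlt⟩ := hlt
  have h1 : i' < i + 1 := by exact_mod_cast hlt
  have h2 : i ≤ i' := by
    have := kappa_le hi'.1 hi'.2
    rw [h] at this
    exact_mod_cast this
  have : i' = i := by omega
  exact this ▸ hi'

/-! ### Simplicity along subsequences -/

open Classical in
variable (S) in
/-- A random matching of the tokens of `(r(N), c(N))` is simple with probability at least `δ`. -/
def SimpleProbGE (δ : ℝ) (N : ℕ) : Prop :=
  δ * Fintype.card (TokenMatching (S.r N) (S.c N)) ≤
    ((Finset.univ.filter fun σ : TokenMatching (S.r N) (S.c N) => IsSimpleMatching σ).card : ℝ)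

lemma tendsto_mul_cast {k : ℕ → ℕ} (hk : StrictMono k) {ε : ℝ} (hε : 0 < ε) :
    Tendsto (fun l => ε * (k l : ℝ)) atTop atTop :=
  (tendsto_natCast_atTop_atTop.comp hk.tendsto_atTop).const_mul_atTop hε

lemma exists_simpleProbGE_of_sparse (hrc : ∀ N, S.col N 1 ≤ S.row N 1) (h1 : S.Condition1)
    {k : ℕ → ℕ} (hk : StrictMono k)
    (ho : (fun l => (S.row (k l) 1 : ℝ)) =o[atTop] fun l => (k l : ℝ)) :
    ∃ δ : ℝ, 0 < δ ∧ ∀ᶠ l in atTop, S.SimpleProbGE δ (k l) := by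
  obtain ⟨C, hC1, hC⟩ := h1.exists_bound
  refine ⟨Real.exp (-(4 * (2 * C))), Real.exp_pos _, ?_⟩
  have hC0 : (0 : ℝ) < C := by exact_mod_cast hC1
  filter_upwards [hk.tendsto_atTop.eventually hC,
    ho.def (show (0 : ℝ) < (4096 * (C : ℝ))⁻¹ by positivity),
    hk.tendsto_atTop.eventually (eventually_ge_atTop (64 * (64 * C) ^ 2))] with l hl hR hN
  rw [Real.norm_of_nonneg (Nat.cast_nonneg _), Real.norm_of_nonneg (Nat.cast_nonneg _),
    ← div_eq_inv_mul, le_div_iff₀ (by positivity), mul_comm] at hR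
  exact le_card_isSimpleMatching_of_sparse (S.sum_r _) (S.sum_c _) (S.r_le_row_one _)
    (S.c_le_col_one _) (hrc _) (S.row_one_sq_le _) (S.col_one_sq_le _) hC1 hl
    (by exact_mod_cast hR) hN

/-- The first row alone contributes at least `(εN)²/2` to the row pair count, so Condition 1 caps
the column pair count at `2C/ε²`. -/
lemma exists_pairCount_bound (h1 : S.Condition1) {k : ℕ → ℕ} (hk : StrictMono k) {ε : ℝ}
    (hε : 0 < ε) (hrow : ∀ l, ε * k l ≤ S.row (k l) 1) :
    ∃ D : ℕ, ∀ᶠ l in atTop, pairCount (S.c (k l)) ≤ D := by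
  obtain ⟨C, hC1, hC⟩ := h1.exists_bound
  refine ⟨⌈2 * C / ε ^ 2⌉₊, ?_⟩
  filter_upwards [hk.tendsto_atTop.eventually hC,
    (tendsto_mul_cast hk hε).eventually (eventually_ge_atTop 2)] with l hl h2
  have hR := hrow l
  have hsq := S.row_one_sq_le (k l)
  have hsq' : (S.row (k l) 1 : ℝ) * S.row (k l) 1 - S.row (k l) 1 ≤ pairCount (S.r (k l)) := by
    have : ((S.row (k l) 1 * S.row (k l) 1 - S.row (k l) 1 : ℕ) : ℝ) ≤ pairCount (S.r (k l)) := by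
      exact_mod_cast hsq
    rwa [Nat.cast_sub (Nat.le_mul_self _), Nat.cast_mul] at this
  have hl' : (pairCount (S.r (k l)) : ℝ) * pairCount (S.c (k l)) ≤ C * (k l * k l) := by
    exact_mod_cast hl
  have hF : (ε * k l) ^ 2 / 2 ≤ pairCount (S.r (k l)) := by nlinarith
  have hk0 : (0 : ℝ) < (k l : ℝ) ^ 2 := by
    have : (k l : ℝ) ≠ 0 := by
      rintro h0
      rw [h0, mul_zero] at h2
      linarith
    positivity
  have hG : (0 : ℝ) ≤ pairCount (S.c (k l)) := Nat.cast_nonneg _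
  have : (pairCount (S.c (k l)) : ℝ) ≤ 2 * C / ε ^ 2 := by
    rw [le_div_iff₀ (by positivity)]
    refine le_of_mul_le_mul_right ?_ hk0
    have := mul_le_mul_of_nonneg_right hF hG
    nlinarith
  exact_mod_cast this.trans (Nat.le_ceil _)

/-- Critical column tokens go to distinct rows of index at least `κ`: these hold `εN` tokens in all,
and each blocks only `r_κ = o(N)`. A positive limsup gives this only infinitely often. -/
lemma frequently_simpleProbGE_of_tail {k : ℕ → ℕ} (hk : StrictMono k) {D : ℕ}
    (hD : ∀ᶠ l in atTop, pairCount (S.c (k l)) ≤ D)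
    (ht : 0 < limsup (fun l => S.tailFraction k l) atTop) :
    ∃ δ : ℝ, 0 < δ ∧ ∃ᶠ l in atTop, S.SimpleProbGE δ (k l) := by
  classical
  have hfreq : ∃ ε : ℝ, 0 < ε ∧ ε ≤ 1 ∧ ∃ᶠ l in atTop, ε < S.tailFraction k l := by
    obtain ⟨ε, hε, hεt⟩ := exists_between ht
    have hb : IsBoundedUnder (· ≥ ·) atTop fun l => S.tailFraction k l :=
      isBoundedUnder_of ⟨0, fun l => Finset.sum_nonneg fun i _ => by positivity⟩
    exact ⟨min ε 1, lt_min hε one_pos, min_le_right _ _,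
      (frequently_lt_of_lt_limsup hb.isCoboundedUnder_le hεt).mono
        fun l hl => (min_le_left _ _).trans_lt hl⟩
  obtain ⟨ε, hε, hε1, hf⟩ := hfreq
  -- For `κ = ∞` the tail is an empty sum.
  have hκ : S.kappa k ≠ ⊤ := by
    intro htop
    obtain ⟨l, hl⟩ := hf.exists
    have : S.tailFraction k l = 0 := by
      rw [tailFraction, htop]
      simp
    linarith
  obtain ⟨i₀, hi₀⟩ := ENat.ne_top_iff_exists.1 hκ
  obtain ⟨hpos, ho⟩ := kappa_spec hi₀.symm
  refine ⟨(ε / 4) ^ D, by positivity, ?_⟩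
  -- The threshold yields `D · r_κ ≤ εN/2`; `D + 1` avoids division by zero.
  refine (hf.and_eventually (hD.and ((ho.def
    (show (0 : ℝ) < ε / (2 * (D + 1)) by positivity)).and
    ((tendsto_mul_cast hk hε).eventually (eventually_ge_atTop 4))))).mono ?_
  rintro l ⟨htail, hDl, hol, h4⟩
  rw [Real.norm_of_nonneg (Nat.cast_nonneg _), Real.norm_of_nonneg (Nat.cast_nonneg _)] at hol
  have hk0 : (0 : ℝ) < k l := by
    by_contra hneg
    have : ε * k l ≤ 0 := mul_nonpos_of_nonneg_of_nonpos hε.le (not_lt.1 hneg)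
    linarith
  refine pow_mul_card_le_card_isSimpleMatching (S.sum_r (k l)) hε hε1 h4 hDl
    (h := S.row (k l) i₀) ?_ Sigma.fst
    (fun _ => Finset.univ.filter fun w : Σ i, Fin (S.r (k l) i) => i₀ ≤ w.1.val + 1) ?_ ?_ ?_
  · rw [div_mul_eq_mul_div, le_div_iff₀ (by positivity)] at hol
    have : (0 : ℝ) ≤ S.row (k l) i₀ := Nat.cast_nonneg _
    linarith
  · intro _ a
    by_cases ha : i₀ ≤ a.val + 1
    · refine le_trans ?_ ((card_tokens_row (r := S.r (k l)) a).le.trans ?_)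
      · exact Finset.card_le_card fun w hw => Finset.mem_filter.2
          ⟨Finset.mem_univ _, (Finset.mem_filter.1 hw).2⟩
      · rw [← row_succ]
        exact S.row_anti _ hpos ha
    · rw [Finset.card_eq_zero.2]
      · exact Nat.zero_le _
      · refine Finset.eq_empty_of_forall_notMem fun w hw => ?_
        obtain ⟨hmem, rfl⟩ := Finset.mem_filter.1 hw
        exact ha (Finset.mem_filter.1 hmem).2
  · intro _
    rw [card_tokens_filter (fun i : Fin (S.m (k l)) => i₀ ≤ i.val + 1),
      ← S.sum_row_filter (k l) (fun i => i₀ ≤ i)]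
    rw [tailFraction, ← hi₀, ← Finset.sum_div, lt_div_iff₀ hk0] at htail
    simp only [Nat.cast_le] at htail
    push_cast
    exact htail.le
  · intro _ _ _ _ _ _ _ _ h
    exact h

/-- The `t`-th token of each column goes to row `t`, so tokens of one column never share a row and
only the distinctness of images has to be arranged: `g = id`, `h = 1`. -/
lemma frequently_simpleProbGE_of_lt_kappa {k : ℕ → ℕ} (hk : StrictMono k) {D : ℕ}
    (hD : ∀ᶠ l in atTop, pairCount (S.c (k l)) ≤ D)
    (hlt : limsup (fun l => (S.col (k l) 1 : ℕ∞)) atTop < S.kappa k) :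
    ∃ δ : ℝ, 0 < δ ∧ ∃ᶠ l in atTop, S.SimpleProbGE δ (k l) := by
  obtain ⟨b, hb⟩ := ENat.ne_top_iff_exists.1 hlt.ne_top
  have hcol : ∀ᶠ l in atTop, S.col (k l) 1 ≤ b := by
    have : limsup (fun l => (S.col (k l) 1 : ℕ∞)) atTop < (b + 1 : ℕ) := by
      rw [← hb]
      exact_mod_cast Nat.lt_succ_self b
    filter_upwards [eventually_lt_of_limsup_lt this] with l hl
    have : S.col (k l) 1 < b + 1 := by exact_mod_cast hl
    omega
  -- `κ` only sees indices from 1 on; `b = 0` would make all columns null.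
  have hb1 : 1 ≤ b := by
    by_contra h0
    obtain ⟨l, hl, hkl⟩ := (hcol.and
      (hk.tendsto_atTop.eventually (eventually_ge_atTop 1))).exists
    have := S.sum_c (k l)
    rw [Finset.sum_eq_zero fun j _ => by have := S.c_le_col_one (k l) j; omega] at this
    omega
  -- Since `b < κ`, row `b` is infinitely often of order `N`, and by monotonicity so are all earlier
  -- rows.
  have hno : ¬ (fun l => (S.row (k l) b : ℝ)) =o[atTop] fun l => (k l : ℝ) := by
    intro ho
    rw [← hb] at hlt
    exact absurd (kappa_le hb1 ho) (not_le.2 hlt)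
  obtain ⟨ε, hε, hε1, hf⟩ := exists_frequently_of_not_isLittleO hno
  refine ⟨(ε / 4) ^ D, by positivity, ?_⟩
  refine (hf.and_eventually (hD.and (hcol.and
    ((tendsto_mul_cast hk hε).eventually (eventually_ge_atTop (2 * (D : ℝ) + 4)))))).mono ?_
  rintro l ⟨hrow, hDl, hcl, h4⟩
  have hD0 : (0 : ℝ) ≤ D := Nat.cast_nonneg _
  refine pow_mul_card_le_card_isSimpleMatching (S.sum_r (k l)) hε hε1 (by linarith) hDl
    (h := 1) (by push_cast; linarith) id
    (fun v => Finset.univ.filter fun w : Σ i, Fin (S.r (k l) i) => w.1.val = v.2.val) ?_ ?_ ?_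
  · intro v a
    refine Finset.card_le_one.2 fun x hx y hy => ?_
    exact (Finset.mem_filter.1 hx).2.trans (Finset.mem_filter.1 hy).2.symm
  · intro v
    have hvb : v.2.val + 1 ≤ b := by
      have := v.2.isLt
      have := S.c_le_col_one (k l) v.1
      omega
    have hle := S.row_anti (k l) (i := v.2.val + 1) (by omega) hvb
    have hle' : ε * k l ≤ S.row (k l) (v.2.val + 1) :=
      hrow.trans (by exact_mod_cast hle)
    -- The target row exists, since rows past the end are 0.
    have hvm : v.2.val < S.m (k l) := by
      by_contra hge
      have h0 : S.row (k l) (v.2.val + 1) = 0 := by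
        rw [row, dif_neg (by omega)]
      rw [h0, Nat.cast_zero] at hle'
      linarith
    have h1 := card_tokens_row (r := S.r (k l)) ⟨v.2.val, hvm⟩
    rw [← row_succ] at h1
    simp only [Fin.ext_iff] at h1
    rw [h1]
    exact hle'
  · intro v v' w w' hne h1 hw hw' h2
    exfalso
    apply hne
    have e : v.2.val = v'.2.val := by
      rw [← (Finset.mem_filter.1 hw).2, ← (Finset.mem_filter.1 hw').2, h2]
    obtain ⟨j, s⟩ := v
    obtain ⟨j', s'⟩ := v'
    cases h1
    cases Fin.ext e
    rfl

lemma exists_frequently_simpleProbGE (hrc : ∀ N, S.col N 1 ≤ S.row N 1) (h1 : S.Condition1)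
    (h2 : S.Condition2) {k : ℕ → ℕ} (hk : StrictMono k) :
    ∃ δ : ℝ, 0 < δ ∧ ∃ᶠ l in atTop, S.SimpleProbGE δ (k l) := by
  by_cases ho : (fun l => (S.row (k l) 1 : ℝ)) =o[atTop] fun l => (k l : ℝ)
  · obtain ⟨δ, hδ, h⟩ := exists_simpleProbGE_of_sparse hrc h1 hk ho
    exact ⟨δ, hδ, h.frequently⟩
  · obtain ⟨ε, hε, -, hf⟩ := exists_frequently_of_not_isLittleO ho
    obtain ⟨ψ, hψ, hrow⟩ := extraction_of_frequently_atTop hf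
    have hkψ : StrictMono (k ∘ ψ) := hk.comp hψ
    obtain ⟨D, hD⟩ := exists_pairCount_bound h1 hkψ hε hrow
    suffices h : ∃ δ : ℝ, 0 < δ ∧ ∃ᶠ l in atTop, S.SimpleProbGE δ ((k ∘ ψ) l) by
      obtain ⟨δ, hδ, h⟩ := h
      exact ⟨δ, hδ, hψ.tendsto_atTop.frequently h⟩
    -- Condition 2 is needed on the refined subsequence, whose `κ` may differ from that of `k`.
    rcases h2 (k ∘ ψ) hkψ with h | h
    · exact frequently_simpleProbGE_of_tail hkψ hD h
    · exact frequently_simpleProbGE_of_lt_kappa hkψ hD h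

/-- The configuration model yields a simple graph with probability bounded away from zero. -/
lemma exists_eventually_simpleProbGE (hrc : ∀ N, S.col N 1 ≤ S.row N 1) (h1 : S.Condition1)
    (h2 : S.Condition2) : ∃ δ : ℝ, 0 < δ ∧ ∀ᶠ N in atTop, S.SimpleProbGE δ N := by
  by_contra! hcon
  have hfreq : ∀ l : ℕ, ∃ᶠ N in atTop, ¬ S.SimpleProbGE (1 / ((l : ℝ) + 1)) N :=
    fun l => hcon _ (by positivity)
  -- Diagonal choice: along `k` the simplicity probability is below `1/(l+1)`.
  obtain ⟨k, hk, hbad⟩ := extraction_forall_of_frequently hfreq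
  obtain ⟨δ, hδ, hgood⟩ := exists_frequently_simpleProbGE hrc h1 h2 hk
  have hsmall : ∀ᶠ l : ℕ in atTop, 1 / ((l : ℝ) + 1) ≤ δ :=
    (tendsto_one_div_add_atTop_nhds_zero_nat.eventually_lt_const hδ).mono fun _ h => h.le
  obtain ⟨l, hl, hle⟩ := (hgood.and_eventually hsmall).exists
  exact hbad l ((mul_le_mul_of_nonneg_right hle (Nat.cast_nonneg _)).trans hl)

end InputSequence

theorem corollary1 (S : InputSequence)
    (hrc : ∀ N, S.col N 1 ≤ S.row N 1)
    (h1 : S.Condition1) (h2 : S.Condition2)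
    (A : BipartiteMultigraph → Prop)
    (hA : Tendsto (fun N => configurationProb (S.r N) (S.c N) A) atTop (𝓝 1)) :
    (∀ᶠ N in atTop, (binaryTables (S.r N) (S.c N)).Nonempty) ∧
      Tendsto (fun N => uniformGraphProb (S.r N) (S.c N) A) atTop (𝓝 1) := by
  obtain ⟨δ, hδ, hev⟩ := InputSequence.exists_eventually_simpleProbGE hrc h1 h2
  have hne : ∀ N, Nonempty (TokenMatching (S.r N) (S.c N)) := fun N =>
    ⟨Fintype.equivOfCardEq (by simp [S.sum_r, S.sum_c])⟩
  have key := hev.mono fun N hN => one_sub_uniformGraphProb_le hδ (hne N) hN A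
  refine ⟨key.mono fun N h => h.1, ?_⟩
  have hlow : Tendsto (fun N => 1 - (1 - configurationProb (S.r N) (S.c N) A) / δ) atTop (𝓝 1) := by
    have := ((hA.const_sub 1).div_const δ).const_sub 1
    simpa using this
  refine tendsto_of_tendsto_of_tendsto_of_le_of_le' hlow tendsto_const_nhds ?_ ?_
  · exact key.mono fun N h => by linarith [h.2.2]
  · exact key.mono fun N h => h.2.1
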